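/- For $\alpha\in(0,1)$ define $$f(\alpha)=\liminf_{p\to\infty}\ \min_{A\subset\mathbb F_p,\ |A|\ge\alpha p}\frac{\max(|A+A|,|A\cdot A|)}{p},$$ where $p$ runs through the primes, $\mathbb F_p$ is the field with $p$ elements, $A+A=\{a+b:a,b\in A\}$ and $A\cdot A=\{ab:a,b\in A\}$. Then, for every $\alpha\in(0,1)$, $$f(\alpha)=\min\Big(1,\ \min_{\ell}\max\Big(2\ell\alpha,\frac1\ell\Big)\Big),$$ where $\ell$ runs over all positive integers. In particular, $f(\alpha)=\min_{\ell}\max(2\ell\alpha,1/\ell)$ for $0<\alpha\le 1/2$, $f(\alpha)=1$ for $1/4\le\alpha<1$, and $f(\alpha)\sim(2\alpha)^{1/2}$ as $\alpha\to0^+$. -/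

import Mathlib

open Filter Topology Asymptotics
open scoped Pointwise

/-- The minimum of `max (|A + A|, |A · A|)` over all subsets `A` of `ℤ/p` with `|A| ≥ α p`. -/
noncomputable def minSumProd (α : ℝ) (p : ℕ) : ℕ :=
  sInf {m : ℕ | ∃ A : Finset (ZMod p), α * p ≤ A.card ∧ m = max (A + A).card (A * A).card}

/-- The lower limit of `minSumProd α p / p` as `p → ∞` through the primes. -/
noncomputable def sumProdLiminf (α : ℝ) : ℝ :=
  liminf (fun p : ℕ => (minSumProd α p : ℝ) / p) (atTop ⊓ 𝓟 {p : ℕ | p.Prime})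

/-- For `α ≤ 1` the minimum is over a nonempty set, hence attained. -/
theorem isLeast_minSumProd {α : ℝ} (hα : α ≤ 1) {p : ℕ} (hp : p.Prime) :
    IsLeast {m : ℕ | ∃ A : Finset (ZMod p), α * p ≤ A.card ∧
      m = max (A + A).card (A * A).card} (minSumProd α p) := by
  haveI := Fact.mk hp
  refine ⟨Nat.sInf_mem ⟨_, Finset.univ, ?_, rfl⟩, fun m hm => Nat.sInf_le hm⟩
  rw [Finset.card_univ, ZMod.card]
  nlinarith [Nat.cast_nonneg (α := ℝ) p]

/-- For `α ≤ 1` the sequence whose lower limit is taken has values in `[0, 1]`. -/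
theorem minSumProd_div_mem {α : ℝ} (hα : α ≤ 1) {p : ℕ} (hp : p.Prime) :
    (minSumProd α p : ℝ) / p ∈ Set.Icc (0 : ℝ) 1 := by
  haveI := Fact.mk hp
  refine ⟨by positivity, ?_⟩
  obtain ⟨A, -, hA⟩ := (isLeast_minSumProd hα hp).1
  have h : minSumProd α p ≤ p := by
    rw [hA]
    refine max_le ?_ ?_ <;> exact (Finset.card_le_univ _).trans (ZMod.card p).le
  exact div_le_one_of_le₀ (by exact_mod_cast h) (by positivity)

section Fourier

set_option linter.unusedSectionVars false

variable {G : Type*} [AddCommGroup G] [Fintype G] [DecidableEq G]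

/-- The Fourier transform of a real function on a finite abelian group. -/
noncomputable def fourierSum (f : G → ℝ) (ψ : AddChar G ℂ) : ℂ := ∑ x, (f x : ℂ) * ψ (-x)

/-- The indicator function of a finite set. -/
noncomputable def ind (A : Finset G) (x : G) : ℝ := if x ∈ A then 1 else 0

/-- The average of a function over the translates by elements of `T`. -/
noncomputable def avg (T : Finset G) (f : G → ℝ) (x : G) : ℝ := (∑ t ∈ T, f (x + t)) / T.card

/-- Additive convolution of functions. -/
noncomputable def conv (f g : G → ℝ) (x : G) : ℝ := ∑ y, f y * g (x - y)

lemma ind_nonneg (A : Finset G) (x : G) : 0 ≤ ind A x := by unfold ind; split_ifs <;> norm_num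

lemma ind_le_one (A : Finset G) (x : G) : ind A x ≤ 1 := by unfold ind; split_ifs <;> norm_num

lemma sum_ind (A : Finset G) : ∑ x, ind A x = A.card := by simp [ind]

lemma fourierSum_inversion (f : G → ℝ) (x : G) :
    ∑ ψ, fourierSum f ψ * ψ x = (Fintype.card G : ℂ) * f x := by
  simp only [fourierSum, Finset.sum_mul]
  rw [Finset.sum_comm]
  have : ∀ y, ∑ ψ : AddChar G ℂ, (f y : ℂ) * ψ (-y) * ψ x
      = if y = x then (Fintype.card G : ℂ) * f y else 0 := by
    intro y
    simp_rw [mul_assoc, ← AddChar.map_add_eq_mul, ← Finset.mul_sum]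
    rw [AddChar.sum_apply_eq_ite]
    by_cases h : y = x
    · simp [h, mul_comm]
    · simp [h, neg_add_eq_zero]
  simp [this]

lemma conj_fourierSum (f : G → ℝ) (ψ : AddChar G ℂ) :
    (starRingEnd ℂ) (fourierSum f ψ) = ∑ x, (f x : ℂ) * ψ x := by
  simp [fourierSum, map_sum, ← AddChar.map_neg_eq_conj]

lemma fourierSum_neg (f : G → ℝ) (ψ : AddChar G ℂ) : fourierSum f (-ψ) = ∑ x, (f x : ℂ) * ψ x := by
  simp [fourierSum]

lemma fourierSum_parseval (f : G → ℝ) :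
    ∑ ψ, ‖fourierSum f ψ‖ ^ 2 = Fintype.card G * ∑ x, f x ^ 2 := by
  have h : ∀ ψ : AddChar G ℂ, ((‖fourierSum f ψ‖ ^ 2 : ℝ) : ℂ) = ∑ x, f x * (fourierSum f ψ * ψ x) := by
    intro ψ
    rw [← Complex.normSq_eq_norm_sq, Complex.normSq_eq_conj_mul_self, conj_fourierSum, Finset.sum_mul]
    exact Finset.sum_congr rfl fun x _ => by ring
  have : ((∑ ψ : AddChar G ℂ, ‖fourierSum f ψ‖ ^ 2 : ℝ) : ℂ) = (Fintype.card G * ∑ x, f x ^ 2 : ℝ) := by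
    rw [Complex.ofReal_sum]
    simp_rw [h]
    rw [Finset.sum_comm]
    simp_rw [← Finset.mul_sum, fourierSum_inversion]
    push_cast
    rw [Finset.mul_sum]
    exact Finset.sum_congr rfl fun x _ => by ring
  exact_mod_cast this

lemma fourierSum_conv (f g : G → ℝ) (ψ : AddChar G ℂ) :
    fourierSum (conv f g) ψ = fourierSum f ψ * fourierSum g ψ := by
  simp only [fourierSum, conv, Complex.ofReal_sum, Finset.sum_mul]
  rw [Finset.sum_comm]
  refine Finset.sum_congr rfl fun y _ => ?_
  rw [Finset.mul_sum, ← Equiv.sum_comp (Equiv.addRight y)]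
  refine Finset.sum_congr rfl fun x _ => ?_
  simp only [Equiv.coe_addRight, add_sub_cancel_right, neg_add, AddChar.map_add_eq_mul]
  push_cast
  ring

lemma fourierSum_sub (f g : G → ℝ) (ψ : AddChar G ℂ) :
    fourierSum (fun x => f x - g x) ψ = fourierSum f ψ - fourierSum g ψ := by
  simp [fourierSum, sub_mul]

lemma fourierSum_avg (T : Finset G) (f : G → ℝ) (ψ : AddChar G ℂ) :
    fourierSum (avg T f) ψ = fourierSum f ψ * ((∑ t ∈ T, ψ t) / T.card) := by
  have : ∀ t, ∑ x, (f (x + t) : ℂ) * ψ (-x) = fourierSum f ψ * ψ t := by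
    intro t
    rw [fourierSum, Finset.sum_mul,
      ← Equiv.sum_comp (Equiv.addRight t) fun x => (f x : ℂ) * ψ (-x) * ψ t]
    refine Finset.sum_congr rfl fun x _ => ?_
    rw [Equiv.coe_addRight, mul_assoc, ← AddChar.map_add_eq_mul, neg_add_rev,
      neg_add_cancel_comm]
  rw [fourierSum]
  simp only [avg, Complex.ofReal_div, Complex.ofReal_sum, Complex.ofReal_natCast, div_mul_eq_mul_div]
  rw [← Finset.sum_div, mul_div_assoc']
  congr 1
  simp_rw [Finset.sum_mul]
  rw [Finset.sum_comm, Finset.mul_sum]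
  exact Finset.sum_congr rfl fun t _ => this t

lemma sum_mul_conv_le (X f g : G → ℝ) (hX : ∀ x, |X x| ≤ 1) (hg : ∀ x, |g x| ≤ 1) {D : ℝ}
    (hf : ∀ ψ, ‖fourierSum f ψ‖ ≤ D) : |∑ x, X x * conv f g x| ≤ D * Fintype.card G := by
  have hD : 0 ≤ D := (norm_nonneg _).trans (hf 0)
  have hN : (0 : ℝ) < Fintype.card G := by exact_mod_cast Fintype.card_pos
  have sq : ∀ h : G → ℝ, (∀ x, |h x| ≤ 1) →
      ∑ ψ, ‖fourierSum h ψ‖ ^ 2 ≤ (Fintype.card G : ℝ) ^ 2 := by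
    intro h hh
    rw [fourierSum_parseval, pow_two]
    gcongr
    calc ∑ x, h x ^ 2 ≤ ∑ _x : G, (1 : ℝ) :=
          Finset.sum_le_sum fun x _ => (sq_le_one_iff_abs_le_one _).2 (hh x)
      _ = _ := by simp
  have key : (Fintype.card G : ℂ) * ((∑ x, X x * conv f g x : ℝ) : ℂ)
      = ∑ ψ, fourierSum f ψ * fourierSum g ψ * fourierSum X (-ψ) := by
    simp_rw [← fourierSum_conv, fourierSum_neg, Finset.mul_sum]
    rw [Finset.sum_comm]
    push_cast
    rw [Finset.mul_sum]
    refine Finset.sum_congr rfl fun x _ => ?_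
    rw [mul_left_comm, ← fourierSum_inversion, Finset.mul_sum]
    exact Finset.sum_congr rfl fun ψ _ => by ring
  have h1 : (Fintype.card G : ℝ) * |∑ x, X x * conv f g x| ≤ D * (Fintype.card G : ℝ) ^ 2 := by
    calc (Fintype.card G : ℝ) * |∑ x, X x * conv f g x|
        = ‖(Fintype.card G : ℂ) * ((∑ x, X x * conv f g x : ℝ) : ℂ)‖ := by
          rw [norm_mul, Complex.norm_real, Complex.norm_natCast, Real.norm_eq_abs]
      _ ≤ ∑ ψ, ‖fourierSum f ψ * fourierSum g ψ * fourierSum X (-ψ)‖ := by rw [key]; exact norm_sum_le _ _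
      _ ≤ ∑ ψ, D * ((‖fourierSum g ψ‖ ^ 2 + ‖fourierSum X (-ψ)‖ ^ 2) / 2) := by
          refine Finset.sum_le_sum fun ψ _ => ?_
          rw [norm_mul, norm_mul, mul_assoc]
          refine mul_le_mul (hf ψ) ?_ (by positivity) hD
          nlinarith [sq_nonneg (‖fourierSum g ψ‖ - ‖fourierSum X (-ψ)‖)]
      _ ≤ D * (Fintype.card G : ℝ) ^ 2 := by
          rw [← Finset.mul_sum, ← Finset.sum_div, Finset.sum_add_distrib]
          have := Equiv.sum_comp (Equiv.neg (AddChar G ℂ)) (fun ψ => ‖fourierSum X ψ‖ ^ 2)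
          simp only [Equiv.neg_apply] at this
          rw [this]
          have := sq X hX
          have := sq g hg
          gcongr
          linarith
  rw [pow_two, ← mul_assoc, mul_comm] at h1
  exact le_of_mul_le_mul_right h1 hN

lemma exists_large_fiber {Y : Type*} [Fintype Y] [DecidableEq Y] (φ : G → Y) :
    ∃ y, Fintype.card G ≤ Fintype.card Y * (Finset.univ.filter fun x => φ x = y).card := by
  by_contra! h
  have h0 : 0 < Fintype.card G := Fintype.card_pos
  have hY : Nonempty Y := ⟨φ 0⟩
  have h1 : Fintype.card G = ∑ y : Y, (Finset.univ.filter fun x => φ x = y).card := by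
    rw [← Finset.card_univ, Finset.card_eq_sum_card_fiberwise (t := Finset.univ) (f := φ) (by simp)]
  have h2 : ∑ y : Y, Fintype.card Y * (Finset.univ.filter fun x => φ x = y).card
      < ∑ _y : Y, Fintype.card G :=
    Finset.sum_lt_sum_of_nonempty Finset.univ_nonempty fun y _ => h y
  rw [← Finset.mul_sum, ← h1] at h2
  simp at h2

lemma exists_dense_almost_periods {δ : ℝ} (hδ : 0 < δ) : ∃ c : ℝ, 0 < c ∧ ∀ (G : Type) [AddCommGroup G] [Fintype G]
    [DecidableEq G] (A : Finset G), ∃ T : Finset G, c * Fintype.card G ≤ T.card ∧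
      ∀ t ∈ T, ∀ ψ : AddChar G ℂ, ‖fourierSum (ind A) ψ‖ * ‖1 - ψ t‖ ≤ δ * Fintype.card G := by
  obtain ⟨Z, -, hZf, hZ⟩ := Metric.finite_approx_of_totallyBounded
    (isCompact_closedBall (0 : ℂ) 1).totallyBounded (δ / 2) (by positivity)
  lift Z to Finset ℂ using hZf
  have hZ' : ∀ z : ℂ, ‖z‖ = 1 → ∃ y : Z, dist z y < δ / 2 := by
    intro z hz
    have := hZ (show z ∈ Metric.closedBall (0 : ℂ) 1 by simp [hz])
    simp only [Set.mem_iUnion] at this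
    obtain ⟨y, hy, h⟩ := this
    exact ⟨⟨y, hy⟩, h⟩
  obtain ⟨y₀, -⟩ := hZ' 1 (by simp)
  have : Nonempty Z := ⟨y₀⟩
  choose! cell hcell using hZ'
  have hZ1 : (1 : ℝ) ≤ Fintype.card Z := by
    exact_mod_cast Fintype.card_pos_iff.2 ⟨cell 1⟩
  set m : ℕ := ⌊4 / δ ^ 2⌋₊
  refine ⟨1 / (Fintype.card Z : ℝ) ^ m, by positivity, ?_⟩
  intro G _ _ _ A
  have hN : (0 : ℝ) < Fintype.card G := by exact_mod_cast Fintype.card_pos (α := G)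
  set P : Finset (AddChar G ℂ) :=
    Finset.univ.filter fun ψ => δ / 2 * Fintype.card G < ‖fourierSum (ind A) ψ‖ with hP
  have hPm : P.card ≤ m := by
    apply Nat.le_floor
    have h1 : (P.card : ℝ) * (δ / 2 * Fintype.card G) ^ 2 ≤ (Fintype.card G : ℝ) ^ 2 := by
      calc (P.card : ℝ) * (δ / 2 * Fintype.card G) ^ 2
          = ∑ _ψ ∈ P, (δ / 2 * Fintype.card G : ℝ) ^ 2 := by simp
        _ ≤ ∑ ψ ∈ P, ‖fourierSum (ind A) ψ‖ ^ 2 := by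
            refine Finset.sum_le_sum fun ψ hψ => ?_
            have := (Finset.mem_filter.1 hψ).2
            gcongr
        _ ≤ ∑ ψ, ‖fourierSum (ind A) ψ‖ ^ 2 :=
            Finset.sum_le_sum_of_subset_of_nonneg (Finset.subset_univ _) fun _ _ _ => by positivity
        _ = Fintype.card G * ∑ x, ind A x ^ 2 := fourierSum_parseval _
        _ ≤ Fintype.card G * ∑ _x : G, (1 : ℝ) := by
            gcongr with x
            exact pow_le_one₀ (ind_nonneg A x) (ind_le_one A x)
        _ = _ := by simp [pow_two]
    rw [le_div_iff₀ (by positivity)]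
    have : (P.card : ℝ) * δ ^ 2 * (Fintype.card G : ℝ) ^ 2 ≤ 4 * (Fintype.card G : ℝ) ^ 2 := by
      nlinarith
    exact le_of_mul_le_mul_right this (by positivity)
  have hcard : ∀ ψ, ‖fourierSum (ind A) ψ‖ ≤ Fintype.card G := by
    intro ψ
    calc ‖fourierSum (ind A) ψ‖ ≤ ∑ x, ‖(ind A x : ℂ) * ψ (-x)‖ := norm_sum_le _ _
      _ ≤ ∑ _x : G, (1 : ℝ) := by
          refine Finset.sum_le_sum fun x _ => ?_
          rw [norm_mul, ψ.norm_apply, mul_one, Complex.norm_real, Real.norm_eq_abs,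
            abs_of_nonneg (ind_nonneg A x)]
          exact ind_le_one A x
      _ = _ := by simp
  classical
  obtain ⟨y, hy⟩ := exists_large_fiber (G := G) (fun x => fun ψ : P => cell (ψ.1 x))
  set W := Finset.univ.filter fun x : G => (fun ψ : P => cell (ψ.1 x)) = y with hW
  have hWne : W.Nonempty := by
    rw [Finset.nonempty_iff_ne_empty]
    intro h
    rw [h] at hy
    simp at hy
  obtain ⟨w, hw⟩ := hWne
  refine ⟨W.image fun x => x - w, ?_, ?_⟩
  · rw [Finset.card_image_of_injective _ (sub_left_injective), div_mul_eq_mul_div, one_mul,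
      div_le_iff₀ (by positivity)]
    have : (Fintype.card G : ℝ) ≤ (Fintype.card Z : ℝ) ^ P.card * W.card := by
      rw [Fintype.card_fun, Fintype.card_coe P] at hy
      exact_mod_cast hy
    calc (Fintype.card G : ℝ) ≤ (Fintype.card Z : ℝ) ^ P.card * W.card := this
      _ ≤ (Fintype.card Z : ℝ) ^ m * W.card := by gcongr
      _ = _ := mul_comm _ _
  · intro t ht ψ
    obtain ⟨x, hx, rfl⟩ := Finset.mem_image.1 ht
    have h1 : ‖1 - ψ (x - w)‖ = dist (ψ w) (ψ x) := by
      have h : ψ w * ψ (x - w) = ψ x := by rw [← AddChar.map_add_eq_mul]; simp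
      rw [dist_eq_norm, ← h, show ψ w - ψ w * ψ (x - w) = ψ w * (1 - ψ (x - w)) by ring,
        norm_mul, ψ.norm_apply, one_mul]
    by_cases hψ : ψ ∈ P
    · have e1 := congrFun (Finset.mem_filter.1 hx).2 ⟨ψ, hψ⟩
      have e2 := congrFun (Finset.mem_filter.1 hw).2 ⟨ψ, hψ⟩
      have d1 := hcell (ψ x) (ψ.norm_apply x)
      have d2 := hcell (ψ w) (ψ.norm_apply w)
      simp only at e1 e2
      rw [e1] at d1
      rw [e2] at d2
      have : dist (ψ w) (ψ x) ≤ δ := by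
        linarith [dist_triangle_right (ψ w) (ψ x) (y ⟨ψ, hψ⟩ : ℂ)]
      rw [h1, mul_comm]
      exact mul_le_mul this (hcard ψ) (norm_nonneg _) hδ.le
    · have h2 : ‖fourierSum (ind A) ψ‖ ≤ δ / 2 * Fintype.card G := by
        simpa [hP] using hψ
      have h3 : ‖1 - ψ (x - w)‖ ≤ 2 := by
        calc ‖1 - ψ (x - w)‖ ≤ ‖(1 : ℂ)‖ + ‖ψ (x - w)‖ := norm_sub_le _ _
          _ = 2 := by rw [ψ.norm_apply, norm_one]; norm_num
      calc _ ≤ (δ / 2 * Fintype.card G) * 2 := mul_le_mul h2 h3 (norm_nonneg _) (by positivity)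
        _ = _ := by ring

end Fourier

section Regularity

set_option linter.unusedSectionVars false

variable {G : Type*} [AddCommGroup G] [Fintype G] [DecidableEq G]

/-- The number of representations of `x` as a sum of two elements of `S`. -/
def sumRep (S : Finset G) (x : G) : ℕ := (S.filter fun a => x - a ∈ S).card

lemma conv_ind_ind (S : Finset G) (x : G) : conv (ind S) (ind S) x = sumRep S x := by
  simp only [conv, ind, sumRep, Finset.card_filter, ite_mul, one_mul, zero_mul,
    Finset.sum_ite_mem, Finset.univ_inter]
  push_cast
  rfl

lemma sumRep_eq_zero {S : Finset G} {x : G} (hx : x ∉ S + S) : sumRep S x = 0 := by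
  rw [sumRep, Finset.card_eq_zero, Finset.filter_eq_empty_iff]
  intro a ha h
  exact hx (Finset.mem_add.2 ⟨a, ha, x - a, h, by abel⟩)

lemma avg_nonneg (T : Finset G) {f : G → ℝ} (hf : ∀ x, 0 ≤ f x) (x : G) : 0 ≤ avg T f x :=
  div_nonneg (Finset.sum_nonneg fun _ _ => hf _) (Nat.cast_nonneg _)

lemma avg_le_one (T : Finset G) {f : G → ℝ} (hf : ∀ x, f x ≤ 1) (x : G) : avg T f x ≤ 1 := by
  refine div_le_one_of_le₀ ?_ (Nat.cast_nonneg _)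
  calc ∑ t ∈ T, f (x + t) ≤ ∑ _t ∈ T, (1 : ℝ) := Finset.sum_le_sum fun t _ => hf _
    _ = T.card := by simp

lemma sum_avg {T : Finset G} (hT : T.Nonempty) (f : G → ℝ) : ∑ x, avg T f x = ∑ x, f x := by
  have hT' : (0 : ℝ) < T.card := by exact_mod_cast hT.card_pos
  simp only [avg]
  rw [← Finset.sum_div, Finset.sum_comm]
  have : ∀ t ∈ T, ∑ x, f (x + t) = ∑ x, f x := fun t _ => Equiv.sum_comp (Equiv.addRight t) f
  rw [Finset.sum_congr rfl this, Finset.sum_const, nsmul_eq_mul, mul_div_cancel_left₀ _ hT'.ne']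

/-- The average over `T` of a character. -/
noncomputable def charAvg (T : Finset G) (ψ : AddChar G ℂ) : ℂ := (∑ t ∈ T, ψ t) / T.card

lemma charAvg_neg (T : Finset G) (ψ : AddChar G ℂ) :
    charAvg (-T) ψ = (starRingEnd ℂ) (charAvg T ψ) := by
  simp [charAvg, Finset.sum_neg_index, ← AddChar.map_neg_eq_conj]

lemma charAvg_eq (T : Finset G) (ψ : AddChar G ℂ) :
    charAvg T ψ = fourierSum (ind T) (-ψ) / T.card := by
  simp [charAvg, fourierSum_neg, ind, apply_ite ((↑) : ℝ → ℂ)]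

lemma norm_charAvg_le_one (T : Finset G) (ψ : AddChar G ℂ) : ‖charAvg T ψ‖ ≤ 1 := by
  rw [charAvg, norm_div, Complex.norm_natCast]
  refine div_le_one_of_le₀ ((norm_sum_le _ _).trans ?_) (Nat.cast_nonneg _)
  simp

lemma sum_norm_fourierSum_neg_sq (A : Finset G) :
    ∑ ψ, ‖fourierSum (ind A) (-ψ)‖ ^ 2 = Fintype.card G * A.card := by
  have := Equiv.sum_comp (Equiv.neg (AddChar G ℂ)) (fun ψ => ‖fourierSum (ind A) ψ‖ ^ 2)
  simp only [Equiv.neg_apply] at this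
  rw [this, fourierSum_parseval, ← sum_ind]
  congr 1
  exact Finset.sum_congr rfl fun x _ => by unfold ind; split_ifs <;> norm_num

lemma sum_norm_fourierSum_sq (A : Finset G) :
    ∑ ψ, ‖fourierSum (ind A) ψ‖ ^ 2 = Fintype.card G * A.card := by
  have := Equiv.sum_comp (Equiv.neg (AddChar G ℂ)) (fun ψ => ‖fourierSum (ind A) ψ‖ ^ 2)
  rw [← this, ← sum_norm_fourierSum_neg_sq]
  rfl

lemma sum_norm_charAvg_sq {T : Finset G} (hT : T.Nonempty) :
    ∑ ψ, ‖charAvg T ψ‖ ^ 2 = Fintype.card G / T.card := by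
  have hT' : (0 : ℝ) < T.card := by exact_mod_cast hT.card_pos
  simp_rw [charAvg_eq, norm_div, div_pow, Complex.norm_natCast]
  rw [← Finset.sum_div, sum_norm_fourierSum_neg_sq]
  field_simp

/-- The smoothing of the indicator function of `A` by the differences of elements of `T`. -/
noncomputable def smooth (A T : Finset G) : G → ℝ := avg T (avg (-T) (ind A))

lemma smooth_nonneg (A T : Finset G) (x : G) : 0 ≤ smooth A T x :=
  avg_nonneg _ (avg_nonneg _ (ind_nonneg A)) x

lemma smooth_le_one (A T : Finset G) (x : G) : smooth A T x ≤ 1 :=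
  avg_le_one _ (avg_le_one _ (ind_le_one A)) x

lemma fourierSum_smooth (A T : Finset G) (ψ : AddChar G ℂ) :
    fourierSum (smooth A T) ψ = fourierSum (ind A) ψ * ((‖charAvg T ψ‖ ^ 2 : ℝ) : ℂ) := by
  rw [smooth, fourierSum_avg, fourierSum_avg, ← charAvg, ← charAvg, charAvg_neg, mul_assoc,
    ← Complex.normSq_eq_norm_sq, Complex.normSq_eq_conj_mul_self]

lemma card_sq_le_sum_smooth {A B T : Finset G} (hT : T.Nonempty) (hB : B ⊆ A) :
    (B.card : ℝ) ^ 2 ≤ Fintype.card G * ∑ x ∈ B, smooth A T x := by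
  have hT' : (0 : ℝ) < T.card := by exact_mod_cast hT.card_pos
  have h1 : ∑ x, ind B x * smooth B T x = ∑ z, (avg T (ind B) z) ^ 2 := by
    have e : ∀ x, ind B x * smooth B T x
        = (∑ t ∈ T, ∑ u ∈ T, ind B x * ind B (x + t - u)) / T.card ^ 2 := by
      intro x
      simp only [smooth, avg, Finset.card_neg, Finset.sum_neg_index, ← Finset.mul_sum]
      rw [← Finset.sum_div]
      simp only [← sub_eq_add_neg]
      field_simp
    have e' : ∀ z, avg T (ind B) z ^ 2
        = (∑ t ∈ T, ∑ u ∈ T, ind B (z + u) * ind B (z + t)) / T.card ^ 2 := by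
      intro z
      rw [avg, div_pow, pow_two (∑ t ∈ T, _), Finset.sum_mul_sum, Finset.sum_comm]
    simp_rw [e, e']
    rw [← Finset.sum_div, ← Finset.sum_div]
    congr 1
    rw [Finset.sum_comm, Finset.sum_comm (s := Finset.univ)]
    refine Finset.sum_congr rfl fun t _ => ?_
    rw [Finset.sum_comm, Finset.sum_comm (s := Finset.univ)]
    refine Finset.sum_congr rfl fun u _ => ?_
    rw [← Equiv.sum_comp (Equiv.addRight u)]
    refine Finset.sum_congr rfl fun x _ => ?_
    rw [Equiv.coe_addRight, show x + u + t - u = x + t by abel]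
  have h2 : (B.card : ℝ) ^ 2 ≤ Fintype.card G * ∑ z, (avg T (ind B) z) ^ 2 := by
    rw [← sum_ind, ← sum_avg hT]
    exact sq_sum_le_card_mul_sum_sq
  have h3 : ∑ x, ind B x * smooth B T x ≤ ∑ x ∈ B, smooth A T x := by
    simp only [ind, ite_mul, one_mul, zero_mul, Finset.sum_ite_mem, Finset.univ_inter]
    refine Finset.sum_le_sum fun x _ => ?_
    simp only [smooth, avg]
    gcongr with t _ u _
    unfold ind
    split_ifs with h h'
    · exact le_rfl
    · exact absurd (hB h) h'
    · exact zero_le_one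
    · exact le_rfl
  rw [h1] at h3
  exact h2.trans (by gcongr)

lemma norm_fourierSum_smooth_sub_le {A T : Finset G} (hT : T.Nonempty) {D : ℝ} (ψ : AddChar G ℂ)
    (h : ∀ t ∈ T, ‖fourierSum (ind A) ψ‖ * ‖1 - ψ t‖ ≤ D) :
    ‖fourierSum (fun x => smooth A T x - ind A x) ψ‖ ≤ 2 * D := by
  have hT' : (0 : ℝ) < T.card := by exact_mod_cast hT.card_pos
  have h1 : ‖fourierSum (ind A) ψ‖ * ‖1 - charAvg T ψ‖ ≤ D := by
    have : 1 - charAvg T ψ = (∑ t ∈ T, (1 - ψ t)) / T.card := by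
      have hT'' : (T.card : ℂ) ≠ 0 := by exact_mod_cast hT'.ne'
      rw [Finset.sum_sub_distrib, charAvg, sub_div]
      simp [hT'']
    rw [this, norm_div, Complex.norm_natCast, ← mul_div_assoc, div_le_iff₀ hT']
    calc ‖fourierSum (ind A) ψ‖ * ‖∑ t ∈ T, (1 - ψ t)‖
        ≤ ‖fourierSum (ind A) ψ‖ * ∑ t ∈ T, ‖1 - ψ t‖ := by gcongr; exact norm_sum_le _ _
      _ = ∑ t ∈ T, ‖fourierSum (ind A) ψ‖ * ‖1 - ψ t‖ := Finset.mul_sum _ _ _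
      _ ≤ ∑ _t ∈ T, D := Finset.sum_le_sum h
      _ = D * T.card := by simp [mul_comm]
  set m := ‖charAvg T ψ‖
  have hm : m ≤ 1 := norm_charAvg_le_one T ψ
  have hm0 : 0 ≤ m := norm_nonneg _
  have h2 : 1 - m ≤ ‖1 - charAvg T ψ‖ := by
    simpa using norm_sub_norm_le (1 : ℂ) (charAvg T ψ)
  rw [fourierSum_sub, fourierSum_smooth]
  have : fourierSum (ind A) ψ * ((m ^ 2 : ℝ) : ℂ) - fourierSum (ind A) ψ
      = -(fourierSum (ind A) ψ * ((1 - m ^ 2 : ℝ) : ℂ)) := by push_cast; ring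
  rw [this, norm_neg, norm_mul, Complex.norm_real, Real.norm_eq_abs, abs_of_nonneg (by nlinarith)]
  calc ‖fourierSum (ind A) ψ‖ * (1 - m ^ 2)
      ≤ ‖fourierSum (ind A) ψ‖ * (2 * ‖1 - charAvg T ψ‖) := by gcongr; nlinarith
    _ ≤ 2 * D := by linarith

lemma abs_smooth_add_sub_le {A T : Finset G} (hT : T.Nonempty) {D : ℝ} (u : G)
    (h : ∀ ψ, ‖fourierSum (ind A) ψ‖ * ‖1 - ψ u‖ ≤ D) (x : G) :
    |smooth A T (x + u) - smooth A T x| ≤ D / T.card := by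
  have hN : (0 : ℝ) < Fintype.card G := by exact_mod_cast Fintype.card_pos
  have e : (Fintype.card G : ℂ) * ((smooth A T (x + u) - smooth A T x : ℝ) : ℂ)
      = ∑ ψ, fourierSum (smooth A T) ψ * (ψ x * (ψ u - 1)) := by
    push_cast
    rw [mul_sub, ← fourierSum_inversion, ← fourierSum_inversion, ← Finset.sum_sub_distrib]
    refine Finset.sum_congr rfl fun ψ _ => ?_
    rw [AddChar.map_add_eq_mul]
    ring
  have : (Fintype.card G : ℝ) * |smooth A T (x + u) - smooth A T x|
      ≤ Fintype.card G * (D / T.card) := by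
    calc (Fintype.card G : ℝ) * |smooth A T (x + u) - smooth A T x|
        = ‖(Fintype.card G : ℂ) * ((smooth A T (x + u) - smooth A T x : ℝ) : ℂ)‖ := by
          rw [norm_mul, Complex.norm_real, Complex.norm_natCast, Real.norm_eq_abs]
      _ ≤ ∑ ψ, ‖fourierSum (smooth A T) ψ * (ψ x * (ψ u - 1))‖ := by
          rw [e]; exact norm_sum_le _ _
      _ ≤ ∑ ψ, D * ‖charAvg T ψ‖ ^ 2 := by
          refine Finset.sum_le_sum fun ψ _ => ?_
          rw [fourierSum_smooth, norm_mul, norm_mul, norm_mul, ψ.norm_apply, one_mul,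
            Complex.norm_real, Real.norm_eq_abs, abs_of_nonneg (by positivity),
            norm_sub_rev (ψ u), mul_right_comm]
          exact mul_le_mul_of_nonneg_right (h ψ) (by positivity)
      _ = Fintype.card G * (D / T.card) := by
          rw [← Finset.mul_sum, sum_norm_charAvg_sq hT]
          ring
  exact le_of_mul_le_mul_left this hN

lemma sum_norm_fourierSum_avg_le {S T : Finset G} (hT : T.Nonempty) :
    ∑ ψ, ‖fourierSum (avg T (ind S)) ψ‖ ≤ (Fintype.card G : ℝ) ^ 2 / T.card := by
  have hT' : (0 : ℝ) < T.card := by exact_mod_cast hT.card_pos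
  have hle : ∀ B : Finset G, (B.card : ℝ) ≤ Fintype.card G := fun B => by
    exact_mod_cast Finset.card_le_univ B
  calc ∑ ψ, ‖fourierSum (avg T (ind S)) ψ‖
      ≤ ∑ ψ, ((‖fourierSum (ind S) ψ‖ ^ 2 + ‖fourierSum (ind T) (-ψ)‖ ^ 2) / 2) / T.card := by
        refine Finset.sum_le_sum fun ψ _ => ?_
        rw [fourierSum_avg, ← charAvg, charAvg_eq, norm_mul, norm_div, Complex.norm_natCast,
          ← mul_div_assoc]
        gcongr
        nlinarith [sq_nonneg (‖fourierSum (ind S) ψ‖ - ‖fourierSum (ind T) (-ψ)‖)]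
    _ ≤ _ := by
        rw [← Finset.sum_div, ← Finset.sum_div, Finset.sum_add_distrib, sum_norm_fourierSum_sq,
          sum_norm_fourierSum_neg_sq]
        gcongr
        nlinarith [hle S, hle T]

lemma sum_mul_conv_smooth_le {A T : Finset G} (hT : T.Nonempty) {D : ℝ}
    (h : ∀ t ∈ T, ∀ ψ, ‖fourierSum (ind A) ψ‖ * ‖1 - ψ t‖ ≤ D) (X : Finset G) :
    ∑ x, ind X x * conv (smooth A T) (smooth A T) x
      ≤ ∑ x, ind X x * conv (ind A) (ind A) x + 4 * D * Fintype.card G := by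
  set f := smooth A T
  have hb : ∀ B : Finset G, ∀ x, |ind B x| ≤ 1 := fun B x =>
    abs_le.2 ⟨by linarith [ind_nonneg B x], ind_le_one B x⟩
  have hfb : ∀ x, |f x| ≤ 1 := fun x =>
    abs_le.2 ⟨by linarith [smooth_nonneg A T x], smooth_le_one A T x⟩
  have hD : ∀ ψ, ‖fourierSum (fun x => f x - ind A x) ψ‖ ≤ 2 * D := fun ψ =>
    norm_fourierSum_smooth_sub_le hT ψ fun t ht => h t ht ψ
  have comm : ∀ g k : G → ℝ, ∀ x, conv g k x = conv k g x := by
    intro g k x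
    rw [conv, conv, ← Equiv.sum_comp (Equiv.subLeft x)]
    exact Finset.sum_congr rfl fun y _ => by simp [mul_comm]
  have e : ∀ x, conv f f x = conv (ind A) (ind A) x + conv (fun x => f x - ind A x) f x
      + conv (fun x => f x - ind A x) (ind A) x := by
    intro x
    rw [comm (fun x => f x - ind A x) (ind A)]
    simp only [conv, ← Finset.sum_add_distrib]
    exact Finset.sum_congr rfl fun y _ => by ring
  have h1 := le_of_abs_le (sum_mul_conv_le (ind X) _ f (hb X) hfb hD)
  have h2 := le_of_abs_le (sum_mul_conv_le (ind X) _ (ind A) (hb X) (hb A) hD)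
  simp_rw [e, mul_add, Finset.sum_add_distrib]
  linarith

/-- A dense subset `A` of a finite abelian group is almost contained in a set `S`, most of whose
popular sums lie in `A + A`, and which majorizes a function with bounded Fourier algebra norm. -/
theorem exists_structured_superset {ε θ : ℝ} (hε : 0 < ε) (hθ : 0 < θ) :
    ∃ M : ℝ, 0 < M ∧ ∀ (G : Type) [AddCommGroup G] [Fintype G] [DecidableEq G] (A : Finset G),
      ∃ (S : Finset G) (F : G → ℝ), (∀ x, 0 ≤ F x) ∧
        ((A.filter fun x => F x < 1).card : ℝ) ≤ ε * Fintype.card G ∧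
        ∑ x, F x = S.card ∧
        ∑ ψ, ‖fourierSum F ψ‖ ≤ M * Fintype.card G ∧
        ((Finset.univ.filter fun x => θ * Fintype.card G ≤ sumRep S x ∧ x ∉ A + A).card : ℝ)
          ≤ ε * Fintype.card G := by
  obtain ⟨c, hc, hT⟩ := exists_dense_almost_periods (δ := ε * θ * ε ^ 2 / 16) (by positivity)
  obtain ⟨c', hc', hU⟩ := exists_dense_almost_periods (δ := c * ε / 2) (by positivity)
  refine ⟨1 / c', by positivity, ?_⟩
  intro G _ _ _ A
  have hN : (0 : ℝ) < Fintype.card G := by exact_mod_cast Fintype.card_pos (α := G)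
  have hne : ∀ T : Finset G, ∀ c : ℝ, 0 < c → c * Fintype.card G ≤ T.card → T.Nonempty := by
    intro T c hc h
    rw [← Finset.card_pos]
    have : (0 : ℝ) < T.card := (by positivity : 0 < c * (Fintype.card G : ℝ)).trans_le h
    exact_mod_cast this
  obtain ⟨T, hTc, hT⟩ := hT G A
  obtain ⟨U, hUc, hU⟩ := hU G A
  have hTne := hne T c hc hTc
  have hUne := hne U c' hc' hUc
  have hT' : (0 : ℝ) < T.card := by exact_mod_cast hTne.card_pos
  have hU' : (0 : ℝ) < U.card := by exact_mod_cast hUne.card_pos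
  set S := Finset.univ.filter fun x => ε / 2 ≤ smooth A T x with hS
  refine ⟨S, avg U (ind S), avg_nonneg _ (ind_nonneg S), ?_, ?_, ?_, ?_⟩
  · set B := A.filter fun x => avg U (ind S) x < 1
    have hB : ∀ x ∈ B, smooth A T x ≤ ε := by
      intro x hx
      by_contra! hlt
      refine (Finset.mem_filter.1 hx).2.ne ?_
      have : ∀ u ∈ U, ind S (x + u) = 1 := by
        intro u hu
        have h1 := abs_smooth_add_sub_le hTne u (hU u hu) x (T := T)
        have h2 : c * ε / 2 * Fintype.card G / T.card ≤ ε / 2 := by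
          rw [div_le_iff₀ hT']
          nlinarith
        have h3 := (abs_le.1 (h1.trans h2)).1
        rw [ind, if_pos]
        simp only [hS, Finset.mem_filter, Finset.mem_univ, true_and]
        linarith
      rw [avg, Finset.sum_congr rfl this]
      simp [hU'.ne']
    have h1 := card_sq_le_sum_smooth hTne (Finset.filter_subset _ A : B ⊆ A)
    have h2 : ∑ x ∈ B, smooth A T x ≤ B.card * ε := by
      calc ∑ x ∈ B, smooth A T x ≤ ∑ _x ∈ B, ε := Finset.sum_le_sum hB
        _ = _ := by simp
    rcases Nat.eq_zero_or_pos B.card with h0 | h0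
    · rw [h0]; push_cast; positivity
    · have h0' : (0 : ℝ) < B.card := by exact_mod_cast h0
      refine le_of_mul_le_mul_left ?_ h0'
      nlinarith
  · rw [sum_avg hUne, sum_ind]
  · refine (sum_norm_fourierSum_avg_le hUne).trans ?_
    rw [div_le_iff₀ hU']
    calc (Fintype.card G : ℝ) ^ 2 = 1 / c' * Fintype.card G * (c' * Fintype.card G) := by
          field_simp
      _ ≤ _ := by gcongr
  · set X := Finset.univ.filter fun x => θ * Fintype.card G ≤ sumRep S x ∧ x ∉ A + A
    have h1 := sum_mul_conv_smooth_le hTne hT X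
    have hind : ∀ g : G → ℝ, ∑ x, ind X x * g x = ∑ x ∈ X, g x := fun g => by
      simp only [ind, ite_mul, one_mul, zero_mul, Finset.sum_ite_mem, Finset.univ_inter]
    rw [hind, hind] at h1
    have h2 : ∑ x ∈ X, conv (ind A) (ind A) x = 0 := by
      refine Finset.sum_eq_zero fun x hx => ?_
      rw [conv_ind_ind, sumRep_eq_zero (Finset.mem_filter.1 hx).2.2, Nat.cast_zero]
    have h3 : ∀ x ∈ X, (ε / 2) ^ 2 * (θ * Fintype.card G) ≤ conv (smooth A T) (smooth A T) x := by
      intro x hx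
      have hSf : ∀ y, ε / 2 * ind S y ≤ smooth A T y := by
        intro y
        unfold ind
        split_ifs with h
        · simpa [hS] using h
        · simpa using smooth_nonneg A T y
      calc (ε / 2) ^ 2 * (θ * Fintype.card G) ≤ (ε / 2) ^ 2 * conv (ind S) (ind S) x := by
            rw [conv_ind_ind]
            gcongr
            exact (Finset.mem_filter.1 hx).2.1
        _ = ∑ y, (ε / 2 * ind S y) * (ε / 2 * ind S (x - y)) := by
            rw [conv, Finset.mul_sum]
            exact Finset.sum_congr rfl fun y _ => by ring
        _ ≤ _ := by
            refine Finset.sum_le_sum fun y _ => ?_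
            exact mul_le_mul (hSf _) (hSf _) (mul_nonneg (by positivity) (ind_nonneg _ _))
              (smooth_nonneg _ _ _)
    have h4 := Finset.sum_le_sum h3
    rw [Finset.sum_const, nsmul_eq_mul] at h4
    have h5 : (X.card : ℝ) * ((ε / 2) ^ 2 * (θ * Fintype.card G))
        ≤ ε * Fintype.card G * ((ε / 2) ^ 2 * (θ * Fintype.card G)) := by
      nlinarith
    exact le_of_mul_le_mul_right h5 (by positivity)

end Regularity

section PopularSums

set_option linter.unusedSectionVars false

variable {G : Type*} [AddCommGroup G] [Fintype G] [DecidableEq G]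

/-- The number of representations of `x` as `a + b` with `a ∈ A` and `b ∈ B`. -/
def pairRep (A B : Finset G) (x : G) : ℕ := (A.filter fun a => x - a ∈ B).card

lemma pairRep_le_right (A B : Finset G) (x : G) : pairRep A B x ≤ B.card := by
  refine Finset.card_le_card_of_injOn (fun a => x - a) (fun a ha => (Finset.mem_filter.1 ha).2) ?_
  exact sub_right_injective.injOn

lemma pairRep_mono_right (A : Finset G) {B C : Finset G} (h : B ⊆ C) (x : G) :
    pairRep A B x ≤ pairRep A C x :=
  Finset.card_le_card (Finset.monotone_filter_right _ fun _ _ ha => h ha)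

lemma pairRep_comm (A B : Finset G) (x : G) : pairRep A B x = pairRep B A x := by
  refine Finset.card_bij' (fun a _ => x - a) (fun a _ => x - a) ?_ ?_ ?_ ?_ <;> simp +contextual

lemma pairRep_union_left {A A' : Finset G} (h : Disjoint A A') (B : Finset G) (x : G) :
    pairRep (A ∪ A') B x = pairRep A B x + pairRep A' B x := by
  rw [pairRep, Finset.filter_union, Finset.card_union_of_disjoint]
  · rfl
  · exact Finset.disjoint_filter_filter h

lemma pairRep_dyson (A B : Finset G) (x : G) :
    pairRep A B x = pairRep (A ∪ B) (A ∩ B) x + pairRep (A \ B) (B \ A) x := by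
  have h1 : pairRep A B x = pairRep (A \ B) B x + pairRep (A ∩ B) B x := by
    rw [← pairRep_union_left (Finset.disjoint_sdiff_inter A B), Finset.sdiff_union_inter]
  have h2 : pairRep B (A \ B) x = pairRep (B \ A) (A \ B) x + pairRep (A ∩ B) (A \ B) x := by
    rw [Finset.inter_comm, ← pairRep_union_left (Finset.disjoint_sdiff_inter B A),
      Finset.sdiff_union_inter]
  have h3 : pairRep (A ∪ B) (A ∩ B) x = pairRep (A \ B) (A ∩ B) x + pairRep B (A ∩ B) x := by
    rw [← pairRep_union_left Finset.sdiff_disjoint, Finset.sdiff_union_self_eq_union]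
  rw [h1, h3, pairRep_comm (A \ B) B, h2, pairRep_comm (A \ B) (B \ A), pairRep_comm (A ∩ B) B,
    pairRep_comm (A ∩ B) (A \ B)]
  ring

lemma sum_pairRep (A B : Finset G) : ∑ x, pairRep A B x = A.card * B.card := by
  simp only [pairRep, Finset.card_filter]
  rw [Finset.sum_comm]
  have : ∀ a ∈ A, ∑ x, (if x - a ∈ B then 1 else 0) = B.card := by
    intro a _
    rw [← Equiv.sum_comp (Equiv.addRight a)]
    simp
  rw [Finset.sum_congr rfl this]
  simp

lemma exists_add_notMem {p : ℕ} [Fact p.Prime] {A : Finset (ZMod p)} (hA : A.Nonempty)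
    (hA' : A ≠ Finset.univ) {d : ZMod p} (hd : d ≠ 0) : ∃ a ∈ A, a + d ∉ A := by
  by_contra! h
  apply hA'
  obtain ⟨a, ha⟩ := hA
  have : ∀ n : ℕ, a + n * d ∈ A := by
    intro n
    induction n with
    | zero => simpa using ha
    | succ n ih =>
      have := h _ ih
      rwa [add_assoc, ← add_one_mul, ← Nat.cast_succ] at this
  refine Finset.eq_univ_of_forall fun x => ?_
  have := this ((x - a) / d).val
  rwa [ZMod.natCast_zmod_val, div_mul_cancel₀ _ hd, add_sub_cancel] at this

/-- Pollard's theorem. -/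
theorem pollard {p : ℕ} [Fact p.Prime] (n : ℕ) : ∀ (t : ℕ) (A B : Finset (ZMod p)), B.card = n →
    t ≤ A.card → t ≤ B.card → A.card + B.card ≤ p + t →
    t * (A.card + B.card) ≤ ∑ x, min t (pairRep A B x) + t * t := by
  induction n using Nat.strong_induction_on with
  | _ n ih =>
  intro t A B hBn htA htB hs
  rcases Nat.eq_zero_or_pos t with rfl | ht
  · simp
  rcases htB.eq_or_lt with h | h
  · have : ∀ x, min t (pairRep A B x) = pairRep A B x := fun x =>
      min_eq_right ((pairRep_le_right A B x).trans h.ge)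
    simp_rw [this, sum_pairRep, ← h]
    exact le_of_eq (by ring)
  have hA : A.Nonempty := Finset.card_pos.1 (by omega)
  have hA' : A ≠ Finset.univ := by
    rintro rfl
    rw [Finset.card_univ, ZMod.card] at hs
    omega
  obtain ⟨b, hb, b', hb', hbb⟩ := Finset.one_lt_card.1 (by omega : 1 < B.card)
  obtain ⟨a, ha, had⟩ := exists_add_notMem hA hA' (sub_ne_zero.2 hbb.symm)
  set C := B.image fun x => x + (a - b) with hC
  have hCc : C.card = B.card := Finset.card_image_of_injective _ (add_left_injective _)
  have hrep : ∀ x, pairRep A C (x + (a - b)) = pairRep A B x := by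
    intro x
    simp only [pairRep]
    congr 1
    refine Finset.filter_congr fun y _ => ?_
    simp only [hC, Finset.mem_image]
    constructor
    · rintro ⟨z, hz, h⟩
      have : x - y = z := by rw [eq_sub_of_add_eq h]; abel
      rwa [this]
    · intro h
      exact ⟨_, h, by abel⟩
  have hsum : ∑ x, min t (pairRep A B x) = ∑ x, min t (pairRep A C x) := by
    simp_rw [← hrep]
    exact Equiv.sum_comp (Equiv.addRight (a - b)) fun x => min t (pairRep A C x)
  have haC : a ∈ C := Finset.mem_image.2 ⟨b, hb, by abel⟩
  have hdC : a + (b' - b) ∈ C := Finset.mem_image.2 ⟨b', hb', by abel⟩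
  have hI0 : 0 < (A ∩ C).card := Finset.card_pos.2 ⟨a, Finset.mem_inter.2 ⟨ha, haC⟩⟩
  have hIC : (A ∩ C).card < C.card := by
    refine Finset.card_lt_card ⟨Finset.inter_subset_right, fun hsub => had ?_⟩
    exact (Finset.mem_inter.1 (hsub hdC)).1
  have hU := Finset.card_union_add_card_inter A C
  have hA0 := Finset.card_sdiff_add_card_inter A C
  have hC0 := Finset.card_sdiff_add_card_inter C A
  rw [Finset.inter_comm C A] at hC0
  rw [hsum, ← hCc]
  rcases le_or_gt t (A ∩ C).card with hle | hgt
  · have := ih _ (by omega) t (A ∪ C) (A ∩ C) rfl (by omega) hle (by omega)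
    rw [hU] at this
    refine this.trans ?_
    gcongr with x
    rw [pairRep_dyson A C x]
    omega
  · have := ih (C \ A).card (by omega) (t - (A ∩ C).card) (A \ C) (C \ A) rfl (by omega) (by omega)
      (by omega)
    have h2 : ∑ x, pairRep (A ∪ C) (A ∩ C) x
        + ∑ x, min (t - (A ∩ C).card) (pairRep (A \ C) (C \ A) x)
        ≤ ∑ x, min t (pairRep A C x) := by
      rw [← Finset.sum_add_distrib]
      refine Finset.sum_le_sum fun x _ => ?_
      have := pairRep_le_right (A ∪ C) (A ∩ C) x
      rw [pairRep_dyson A C x]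
      omega
    rw [sum_pairRep] at h2
    obtain ⟨k, rfl⟩ := Nat.exists_eq_add_of_lt hgt
    rw [show (A ∩ C).card + k + 1 - (A ∩ C).card = k + 1 by omega] at this h2
    have hU' : (A ∪ C).card = (A \ C).card + (C \ A).card + (A ∩ C).card := by omega
    rw [hU'] at h2
    rw [← hA0, ← hC0]
    nlinarith

lemma le_card_popular_add {G : Type*} [Fintype G] (r : G → ℕ) (t : ℕ) (τ : ℝ) (hτ : 0 ≤ τ) :
    ((∑ x, min t (r x) : ℕ) : ℝ)
      ≤ t * (Finset.univ.filter fun x => τ ≤ r x).card + τ * Fintype.card G := by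
  push_cast
  calc ∑ x, min (t : ℝ) (r x) ≤ ∑ x, (t * (if τ ≤ r x then 1 else 0) + τ) := by
        refine Finset.sum_le_sum fun x _ => ?_
        split_ifs with h
        · linarith [min_le_left (t : ℝ) (r x)]
        · linarith [min_le_right (t : ℝ) (r x)]
    _ = _ := by
        rw [Finset.sum_add_distrib, ← Finset.mul_sum]
        simp [mul_comm]

/-- In `ℤ/p` the popular sums satisfy the Cauchy-Davenport bound up to a small error. -/
theorem card_popular_sums_zmod {ε : ℝ} (hε : 0 < ε) {p : ℕ} [Fact p.Prime] (hp : 4 / ε ≤ p)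
    (S : Finset (ZMod p)) : min (p : ℝ) (2 * S.card) - ε * p
      ≤ (Finset.univ.filter fun x => ε ^ 2 / 8 * p ≤ sumRep S x).card := by
  have hp0 : (0 : ℝ) < p := by exact_mod_cast (Fact.out : p.Prime).pos
  rw [div_le_iff₀ hε] at hp
  set t := ⌊ε * p / 2⌋₊ with ht
  have ht1 : (t : ℝ) ≤ ε * p / 2 := Nat.floor_le (by positivity)
  have ht2 : ε * p / 4 ≤ t := by
    have := Nat.lt_floor_add_one (ε * p / 2)
    rw [← ht] at this
    linarith
  have ht0 : (0 : ℝ) < t := lt_of_lt_of_le (by positivity) ht2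
  set P := Finset.univ.filter fun x => ε ^ 2 / 8 * p ≤ sumRep S x
  rcases lt_or_ge S.card t with hlt | hge
  · have : (S.card : ℝ) < t := by exact_mod_cast hlt
    have := min_le_right (p : ℝ) (2 * S.card)
    have : (0 : ℝ) ≤ P.card := Nat.cast_nonneg _
    linarith
  have key : (t : ℝ) * (min (p : ℝ) (2 * S.card) - t) ≤ (∑ x, min t (sumRep S x) : ℕ) := by
    rcases le_or_gt (S.card + S.card) (p + t) with h | h
    · have := pollard _ t S S rfl hge hge h
      have : (t : ℝ) * (S.card + S.card) ≤ (∑ x, min t (sumRep S x) : ℕ) + t * t := by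
        exact_mod_cast this
      have := mul_le_mul_of_nonneg_left (min_le_right (p : ℝ) (2 * S.card)) ht0.le
      linarith
    · have hSp : S.card ≤ p := (Finset.card_le_univ S).trans (ZMod.card p).le
      obtain ⟨B, hBS, hB⟩ := Finset.exists_subset_card_eq (by omega : p + t - S.card ≤ S.card)
      have := pollard _ t S B rfl hge (by omega) (by omega)
      rw [hB, show S.card + (p + t - S.card) = p + t by omega] at this
      have h2 : ∑ x, min t (pairRep S B x) ≤ ∑ x, min t (sumRep S x) :=
        Finset.sum_le_sum fun x _ => min_le_min_left _ (pairRep_mono_right S hBS x)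
      have : (t : ℝ) * (p + t) ≤ (∑ x, min t (sumRep S x) : ℕ) + t * t := by
        exact_mod_cast this.trans (by gcongr)
      have := mul_le_mul_of_nonneg_left (min_le_left (p : ℝ) (2 * S.card)) ht0.le
      nlinarith
  have h2 := le_card_popular_add (sumRep S) t (ε ^ 2 / 8 * p) (by positivity)
  rw [ZMod.card] at h2
  have h3 : ε ^ 2 / 8 * p * p ≤ t * (ε * p / 2) := by
    calc ε ^ 2 / 8 * p * p = ε * p / 4 * (ε * p / 2) := by ring
      _ ≤ _ := by gcongr
  have h4 : (t : ℝ) * (min (p : ℝ) (2 * S.card) - t) ≤ t * (P.card + ε * p / 2) := by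
    linarith
  have := le_of_mul_le_mul_left h4 ht0
  linarith

lemma two_mul_card_le_sumRep_add {S S' C : Finset G} {x : G} (h1 : S' ⊆ S) (h2 : S' ⊆ C)
    (h3 : ∀ a ∈ S', x - a ∈ C) : 2 * S'.card ≤ sumRep S x + C.card := by
  have hi : (S'.image fun a => x - a).card = S'.card :=
    Finset.card_image_of_injective _ sub_right_injective
  have h4 := Finset.card_union_add_card_inter S' (S'.image fun a => x - a)
  have h5 : (S' ∪ S'.image fun a => x - a).card ≤ C.card := by
    refine Finset.card_le_card (Finset.union_subset h2 fun y hy => ?_)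
    obtain ⟨a, ha, rfl⟩ := Finset.mem_image.1 hy
    exact h3 a ha
  have h6 : (S' ∩ S'.image fun a => x - a).card ≤ sumRep S x := by
    refine Finset.card_le_card fun y hy => ?_
    obtain ⟨hy, hy'⟩ := Finset.mem_inter.1 hy
    obtain ⟨a, ha, rfl⟩ := Finset.mem_image.1 hy'
    exact Finset.mem_filter.2 ⟨h1 hy, by simpa using h1 ha⟩
  omega

/-- A set of differences in which every element is represented by more than half of `S` is a
subgroup. -/
lemma card_le_mul_card_sub_self {S : Finset G} (hS : S.Nonempty) {l : ℕ}
    (hl : Fintype.card G < (l + 1) * S.card)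
    (hD : ∀ h ∈ S - S, S.card < 2 * (S.filter fun b => b + h ∈ S).card) :
    (∀ g ∈ S - S, ∀ h ∈ S - S, g - h ∈ S - S) ∧ Fintype.card G ≤ l * (S - S).card := by
  have hcl : ∀ g ∈ S - S, ∀ h ∈ S - S, g - h ∈ S - S := by
    intro g hg h hh
    have h1 := hD g hg
    have h2 := hD h hh
    have h3 := Finset.card_union_add_card_inter (S.filter fun b => b + g ∈ S)
      (S.filter fun b => b + h ∈ S)
    have h4 : ((S.filter fun b => b + g ∈ S) ∪ (S.filter fun b => b + h ∈ S)).card ≤ S.card :=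
      Finset.card_le_card (Finset.union_subset (Finset.filter_subset _ _)
        (Finset.filter_subset _ _))
    obtain ⟨b, hb⟩ := Finset.card_pos.1 (by omega :
      0 < ((S.filter fun b => b + g ∈ S) ∩ (S.filter fun b => b + h ∈ S)).card)
    rw [Finset.mem_inter, Finset.mem_filter, Finset.mem_filter] at hb
    exact Finset.mem_sub.2 ⟨b + g, hb.1.2, b + h, hb.2.2, by abel⟩
  refine ⟨hcl, ?_⟩
  obtain ⟨s, hs⟩ := hS
  have h0 : (0 : G) ∈ S - S := Finset.mem_sub.2 ⟨s, hs, s, hs, sub_self s⟩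
  have hneg : ∀ g ∈ S - S, -g ∈ S - S := fun g hg => by simpa using hcl 0 h0 g hg
  let K : AddSubgroup G :=
    { carrier := ↑(S - S)
      add_mem' := by
        intro a b ha hb
        have := hcl a ha (-b) (hneg b hb)
        rwa [sub_neg_eq_add] at this
      zero_mem' := h0
      neg_mem' := fun {x} hx => hneg x hx }
  have hK : Nat.card K = (S - S).card := by
    exact Set.ncard_coe_finset (S - S)
  have hlag := K.card_mul_index
  rw [hK, Nat.card_eq_fintype_card] at hlag
  have hSS : S.card ≤ (S - S).card := by
    rw [← Finset.card_image_of_injective S (sub_left_injective (b := s))]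
    refine Finset.card_le_card fun y hy => ?_
    obtain ⟨a, ha, rfl⟩ := Finset.mem_image.1 hy
    exact Finset.sub_mem_sub ha hs
  have : K.index < l + 1 := by
    by_contra! hge
    have : (l + 1) * S.card ≤ (S - S).card * K.index := by
      rw [mul_comm]
      exact Nat.mul_le_mul hSS hge
    omega
  rw [← hlag, mul_comm]
  exact Nat.mul_le_mul_right _ (by omega)

/-- A set of density larger than `1 / (l + 1)` has popular sums of density at least `1 / l`. -/
theorem card_popular_sums {l : ℕ} (hl : 1 ≤ l) {ε : ℝ} (hε : 0 < ε) (hε1 : ε ≤ 1) {S : Finset G}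
    (hS : (1 / (l + 1) + ε) * Fintype.card G ≤ S.card) :
    Fintype.card G ≤
      l * (Finset.univ.filter fun x => (ε / 8) ^ 2 * Fintype.card G ≤ sumRep S x).card := by
  have hN : (0 : ℝ) < Fintype.card G := by exact_mod_cast Fintype.card_pos (α := G)
  set N : ℝ := ((Fintype.card G : ℕ) : ℝ) with hNdef
  set P := Finset.univ.filter fun x => (ε / 8) ^ 2 * N ≤ sumRep S x with hP
  have hpop : ∀ x, 2 * ε * N ≤ sumRep S x → x ∈ P := by
    intro x hx
    refine Finset.mem_filter.2 ⟨Finset.mem_univ _, le_trans ?_ hx⟩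
    gcongr
    nlinarith
  rcases hl.eq_or_lt with rfl | hl2
  · have : P = Finset.univ := by
      refine Finset.eq_univ_of_forall fun x => hpop x ?_
      have := two_mul_card_le_sumRep_add (x := x) (Finset.Subset.refl S) (Finset.subset_univ S)
        fun a _ => Finset.mem_univ _
      have : 2 * (S.card : ℝ) ≤ sumRep S x + N := by
        rw [Finset.card_univ] at this
        rw [hNdef]
        exact_mod_cast this
      norm_num at hS
      linarith
    rw [this, one_mul, Finset.card_univ]
  by_contra! hlt
  have hl' : (2 : ℝ) ≤ l := by exact_mod_cast hl2
  have hP' : (P.card : ℝ) ≤ 3 / 2 * (S.card - ε * N) := by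
    have h1 : (l : ℝ) * P.card ≤ N := by rw [hNdef]; exact_mod_cast hlt.le
    have h2 : N ≤ (l + 1) * (S.card - ε * N) := by
      have : 1 / ((l : ℝ) + 1) * N ≤ S.card - ε * N := by linarith
      rwa [div_mul_eq_mul_div, one_mul, div_le_iff₀ (by positivity), mul_comm] at this
    have h3 : 0 ≤ S.card - ε * N := by
      by_contra! h
      nlinarith
    have h4 : (l : ℝ) * P.card ≤ l * (3 / 2 * (S.card - ε * N)) := by nlinarith
    exact le_of_mul_le_mul_left h4 (by positivity)
  set bad : G → ℕ := fun a => (S.filter fun b => a + b ∉ P).card with hbad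
  set S₀ := S.filter fun a => (bad a : ℝ) ≤ ε / 8 * N with hS₀
  have hbadsum : ((∑ a ∈ S, bad a : ℕ) : ℝ) ≤ (ε / 8) ^ 2 * N * N := by
    have e : ∑ a ∈ S, bad a = ∑ x ∈ Finset.univ.filter (fun x => x ∉ P), sumRep S x := by
      simp only [hbad, sumRep, Finset.card_filter, Finset.sum_filter]
      have : ∀ a ∈ S, (∑ b ∈ S, if a + b ∉ P then 1 else 0)
          = ∑ x, if x ∉ P then (if x - a ∈ S then 1 else 0) else 0 := by
        intro a _
        rw [← Equiv.sum_comp (Equiv.addLeft a)]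
        simp only [Equiv.coe_addLeft, add_sub_cancel_left]
        rw [← Finset.sum_filter_add_sum_filter_not Finset.univ (fun b => b ∈ S)]
        rw [Finset.sum_eq_zero (s := Finset.univ.filter fun b => b ∉ S), add_zero]
        · rw [Finset.filter_mem_eq_inter, Finset.univ_inter]
          exact Finset.sum_congr rfl fun b hb => by simp [hb]
        · intro b hb
          simp [(Finset.mem_filter.1 hb).2]
      rw [Finset.sum_congr rfl this, Finset.sum_comm]
      refine Finset.sum_congr rfl fun x _ => ?_
      split_ifs <;> simp
    rw [e]
    push_cast
    calc ∑ x ∈ Finset.univ.filter (fun x => x ∉ P), (sumRep S x : ℝ)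
        ≤ ∑ x ∈ Finset.univ.filter (fun x => x ∉ P), (ε / 8) ^ 2 * N := by
          refine Finset.sum_le_sum fun x hx => ?_
          by_contra! h
          exact (Finset.mem_filter.1 hx).2 (Finset.mem_filter.2 ⟨Finset.mem_univ _, h.le⟩)
      _ ≤ ∑ x : G, (ε / 8) ^ 2 * N :=
          Finset.sum_le_sum_of_subset_of_nonneg (Finset.subset_univ _) fun _ _ _ => by positivity
      _ = _ := by simp [hNdef, mul_comm]
  have hS₀S : S₀ ⊆ S := Finset.filter_subset _ _
  have hcard : (S.card : ℝ) ≤ S₀.card + ε / 8 * N := by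
    have h1 : (((S \ S₀).card : ℕ) : ℝ) * (ε / 8 * N) ≤ (ε / 8 * N) * (ε / 8 * N) := by
      calc (((S \ S₀).card : ℕ) : ℝ) * (ε / 8 * N) = ∑ _a ∈ S \ S₀, ε / 8 * N := by simp
        _ ≤ ∑ a ∈ S \ S₀, (bad a : ℝ) := by
            refine Finset.sum_le_sum fun a ha => ?_
            by_contra! h
            rw [Finset.mem_sdiff] at ha
            exact ha.2 (Finset.mem_filter.2 ⟨ha.1, h.le⟩)
        _ ≤ ∑ a ∈ S, (bad a : ℝ) :=
            Finset.sum_le_sum_of_subset_of_nonneg Finset.sdiff_subset fun _ _ _ => by positivity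
        _ ≤ _ := by push_cast at hbadsum; linarith
    have h2 := le_of_mul_le_mul_right h1 (by positivity)
    have h3 : ((S \ S₀).card : ℝ) + S₀.card = S.card := by
      exact_mod_cast Finset.card_sdiff_add_card_eq_card hS₀S
    linarith
  have hS₀le : (S₀.card : ℝ) ≤ S.card := by exact_mod_cast Finset.card_le_card hS₀S
  have hD : ∀ h ∈ S₀ - S₀,
      (S.card : ℝ) / 2 + ε * N ≤ (S₀.filter fun b => b + h ∈ S₀).card := by
    intro h hh
    obtain ⟨a, ha, a', ha', rfl⟩ := Finset.mem_sub.1 hh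
    set Q : G → Finset G := fun a => (S₀.filter fun b => a + b ∈ P).image fun b => a + b with hQ
    have hQc : ∀ a ∈ S₀, (S₀.card : ℝ) - ε / 8 * N ≤ (Q a).card := by
      intro a ha
      rw [hQ, Finset.card_image_of_injective _ (add_right_injective a)]
      have h1 := Finset.card_filter_add_card_filter_not (s := S₀) (fun b => a + b ∈ P)
      have h2 : (S₀.filter fun b => a + b ∉ P).card ≤ bad a :=
        Finset.card_le_card (Finset.filter_subset_filter _ hS₀S)
      have h3 : (S₀.card : ℝ) ≤ (S₀.filter fun b => a + b ∈ P).card + bad a := by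
        exact_mod_cast (by omega :
          S₀.card ≤ (S₀.filter fun b => a + b ∈ P).card + bad a)
      have h4 := (Finset.mem_filter.1 ha).2
      linarith
    have hQP : ∀ a, Q a ⊆ P := by
      intro a y hy
      obtain ⟨b, hb, rfl⟩ := Finset.mem_image.1 hy
      exact (Finset.mem_filter.1 hb).2
    have h1 := Finset.card_union_add_card_inter (Q a) (Q a')
    have h2 := Finset.card_le_card (Finset.union_subset (hQP a) (hQP a'))
    have h3 : (Q a ∩ Q a').card ≤ (S₀.filter fun b => b + (a - a') ∈ S₀).card := by
      refine Finset.card_le_card_of_injOn (fun y => y - a) (fun y hy => ?_)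
        sub_left_injective.injOn
      obtain ⟨hy, hy'⟩ := Finset.mem_inter.1 hy
      obtain ⟨b, hb, rfl⟩ := Finset.mem_image.1 hy
      obtain ⟨b', hb', he⟩ := Finset.mem_image.1 hy'
      have e : b + (a - a') = b' := by
        have : b' = a + b - a' := by rw [← he]; abel
        rw [this]; abel
      simp only [add_sub_cancel_left, Finset.coe_filter, Set.mem_ofPred_eq, e]
      exact ⟨(Finset.mem_filter.1 hb).1, (Finset.mem_filter.1 hb').1⟩
    have h4 : ((Q a).card : ℝ) + (Q a').card
        ≤ P.card + (S₀.filter fun b => b + (a - a') ∈ S₀).card := by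
      exact_mod_cast (by omega)
    linarith [hQc a ha, hQc a' ha']
  have hS₀big : N < (l + 1) * S₀.card := by
    have : 1 / ((l : ℝ) + 1) * N < S₀.card := by nlinarith
    rwa [div_mul_eq_mul_div, one_mul, div_lt_iff₀ (by positivity), mul_comm] at this
  have hS₀pos : (0 : ℝ) < S₀.card := by
    by_contra! h
    nlinarith
  have hne : S₀.Nonempty := Finset.card_pos.1 (by exact_mod_cast hS₀pos)
  obtain ⟨hcl, hH⟩ := card_le_mul_card_sub_self (l := l) hne
    (by rw [hNdef] at hS₀big; exact_mod_cast hS₀big) (by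
    intro h hh
    have h1 := hD h hh
    have : (S₀.card : ℝ) < 2 * (S₀.filter fun b => b + h ∈ S₀).card := by nlinarith
    exact_mod_cast this)
  obtain ⟨a, ha⟩ := hne
  set H := S₀ - S₀ with hHdef
  have hmem : ∀ s ∈ S₀, s - a ∈ H := fun s hs => Finset.sub_mem_sub hs ha
  have hSH : (S₀.card : ℝ) ≤ H.card := by
    rw [← Finset.card_image_of_injective S₀ (sub_left_injective (b := a))]
    have : S₀.image (fun s => s - a) ⊆ H := fun y hy => by
      obtain ⟨s, hs, rfl⟩ := Finset.mem_image.1 hy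
      exact hmem s hs
    exact_mod_cast Finset.card_le_card this
  have hHle : (H.card : ℝ) / 2 + ε * N ≤ S₀.card := by
    have h1 : ∑ h ∈ H, (S₀.filter fun b => b + h ∈ S₀).card ≤ S₀.card * S₀.card := by
      calc ∑ h ∈ H, (S₀.filter fun b => b + h ∈ S₀).card
          ≤ ∑ h, (S₀.filter fun b => b + h ∈ S₀).card :=
            Finset.sum_le_sum_of_subset (Finset.subset_univ _)
        _ = S₀.card * S₀.card := by
            simp only [Finset.card_filter]
            rw [Finset.sum_comm]
            have : ∀ b ∈ S₀, ∑ h, (if b + h ∈ S₀ then 1 else 0) = S₀.card := by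
              intro b _
              exact (Equiv.sum_comp (Equiv.addLeft b) fun y => if y ∈ S₀ then 1 else 0).trans
                (by simp)
            rw [Finset.sum_congr rfl this]
            simp
    have h2 : (H.card : ℝ) * (S.card / 2 + ε * N) ≤ S₀.card * S₀.card := by
      calc (H.card : ℝ) * (S.card / 2 + ε * N) = ∑ _h ∈ H, ((S.card : ℝ) / 2 + ε * N) := by
            rw [Finset.sum_const, nsmul_eq_mul]
        _ ≤ ∑ h ∈ H, ((S₀.filter fun b => b + h ∈ S₀).card : ℝ) := Finset.sum_le_sum hD
        _ ≤ _ := by exact_mod_cast h1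
    have h3 : (S₀.card : ℝ) * (H.card / 2 + ε * N) ≤ S₀.card * S₀.card := by
      have : 0 ≤ ε * N := by positivity
      nlinarith
    exact le_of_mul_le_mul_left h3 hS₀pos
  have hHP : H.card ≤ P.card := by
    refine Finset.card_le_card_of_injOn (fun h => a + a + h) (fun h hh => hpop _ ?_)
      (add_right_injective _).injOn
    have hCc : (H.image fun h => a + h).card = H.card :=
      Finset.card_image_of_injective _ (add_right_injective a)
    have := two_mul_card_le_sumRep_add (x := a + a + h) (C := H.image fun h => a + h) hS₀S
      (fun s hs => Finset.mem_image.2 ⟨s - a, hmem s hs, by abel⟩)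
      (fun s hs => Finset.mem_image.2 ⟨h - (s - a), hcl h hh _ (hmem s hs), by abel⟩)
    rw [hCc] at this
    have : 2 * (S₀.card : ℝ) ≤ sumRep S (a + a + h) + H.card := by exact_mod_cast this
    linarith
  have := Nat.mul_le_mul_left l hHP
  omega

end PopularSums

section Independence

variable {p : ℕ} [Fact p.Prime]

/-- The correlation of a multiplicative and an additive character of `ℤ/p`. -/
noncomputable def charCorr (χ : AddChar (Additive (ZMod p)ˣ) ℂ) (ψ : AddChar (ZMod p) ℂ) : ℂ :=
  ∑ u : (ZMod p)ˣ, χ (Additive.ofMul u) * ψ u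

lemma norm_charCorr_mulShift (χ : AddChar (Additive (ZMod p)ˣ) ℂ) (ψ : AddChar (ZMod p) ℂ)
    (a : (ZMod p)ˣ) : ‖charCorr χ (ψ.mulShift a)‖ = ‖charCorr χ ψ‖ := by
  have : charCorr χ ψ = χ (Additive.ofMul a) * charCorr χ (ψ.mulShift a) := by
    simp only [charCorr, Finset.mul_sum]
    rw [← Equiv.sum_comp (Equiv.mulLeft a)]
    refine Finset.sum_congr rfl fun u _ => ?_
    rw [Equiv.coe_mulLeft, ofMul_mul, AddChar.map_add_eq_mul, AddChar.mulShift_apply, Units.val_mul,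
      mul_assoc]
  rw [this, norm_mul, AddChar.norm_apply, one_mul]

lemma norm_charCorr_le (χ : AddChar (Additive (ZMod p)ˣ) ℂ) {ψ : AddChar (ZMod p) ℂ}
    (hψ : ψ ≠ 0) : ‖charCorr χ ψ‖ ≤ √p := by
  have hp : 1 < p := (Fact.out : p.Prime).one_lt
  have hprim : ψ.IsPrimitive := AddChar.IsPrimitive.of_ne_one hψ
  have hcard : Fintype.card (ZMod p)ˣ = p - 1 := ZMod.card_units p
  have hsq : ∀ a : ZMod p, ((‖charCorr χ (ψ.mulShift a)‖ ^ 2 : ℝ) : ℂ)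
      = ∑ u : (ZMod p)ˣ, ∑ v : (ZMod p)ˣ, χ (Additive.ofMul u) * χ (-Additive.ofMul v)
        * ψ (a * ((u : ZMod p) - v)) := by
    intro a
    rw [← Complex.normSq_eq_norm_sq, ← Complex.mul_conj, charCorr, map_sum, Finset.sum_mul_sum]
    refine Finset.sum_congr rfl fun u _ => Finset.sum_congr rfl fun v _ => ?_
    rw [map_mul, ← AddChar.map_neg_eq_conj, ← AddChar.map_neg_eq_conj, AddChar.mulShift_apply,
      AddChar.mulShift_apply, mul_sub, sub_eq_add_neg (a * (u : ZMod p)), AddChar.map_add_eq_mul,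
      mul_neg]
    ring
  have hsum : ∑ a : ZMod p, ‖charCorr χ (ψ.mulShift a)‖ ^ 2 = p * (p - 1 : ℕ) := by
    have : ((∑ a : ZMod p, ‖charCorr χ (ψ.mulShift a)‖ ^ 2 : ℝ) : ℂ) = p * (p - 1 : ℕ) := by
      rw [Complex.ofReal_sum]
      simp_rw [hsq]
      rw [Finset.sum_comm]
      have : ∀ u : (ZMod p)ˣ, ∑ a : ZMod p, ∑ v : (ZMod p)ˣ, χ (Additive.ofMul u)
          * χ (-Additive.ofMul v) * ψ (a * ((u : ZMod p) - v)) = p := by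
        intro u
        rw [Finset.sum_comm]
        simp_rw [← Finset.mul_sum, AddChar.sum_mulShift _ hprim, sub_eq_zero, Units.val_inj]
        rw [Finset.sum_eq_single u]
        · simp [← AddChar.map_add_eq_mul]
        · intro v _ hv
          simp [hv.symm]
        · simp
      rw [Finset.sum_congr rfl fun u _ => this u]
      simp [hcard, mul_comm]
    exact_mod_cast this
  have hunits : ((p - 1 : ℕ) : ℝ) * ‖charCorr χ ψ‖ ^ 2 ≤ (p - 1 : ℕ) * p := by
    calc ((p - 1 : ℕ) : ℝ) * ‖charCorr χ ψ‖ ^ 2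
        = ∑ a : (ZMod p)ˣ, ‖charCorr χ (ψ.mulShift (a : ZMod p))‖ ^ 2 := by
          simp_rw [norm_charCorr_mulShift]
          simp [hcard]
      _ = ∑ a ∈ Finset.univ.map ⟨((↑) : (ZMod p)ˣ → ZMod p), Units.val_injective⟩,
            ‖charCorr χ (ψ.mulShift a)‖ ^ 2 := by rw [Finset.sum_map]; rfl
      _ ≤ ∑ a : ZMod p, ‖charCorr χ (ψ.mulShift a)‖ ^ 2 :=
          Finset.sum_le_sum_of_subset_of_nonneg (Finset.subset_univ _) fun _ _ _ => by positivity
      _ = _ := by rw [hsum, mul_comm]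
  refine Real.le_sqrt_of_sq_le (le_of_mul_le_mul_left hunits ?_)
  exact_mod_cast Nat.sub_pos_of_lt hp

/-- Functions with small additive and multiplicative Fourier algebra norms, respectively, are
almost independent. -/
theorem sum_units_mul_le {F : ZMod p → ℝ} {F' : Additive (ZMod p)ˣ → ℝ} {M M' : ℝ}
    (hF : ∑ ψ, ‖fourierSum F ψ‖ ≤ M * p)
    (hF' : ∑ χ, ‖fourierSum F' χ‖ ≤ M' * Fintype.card (Additive (ZMod p)ˣ)) :
    ∑ u : (ZMod p)ˣ, F u * F' (Additive.ofMul u)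
      ≤ (∑ x, F x) * (∑ u, F' u) / p + M * M' * √p := by
  have hp : (0 : ℝ) < p := by exact_mod_cast (Fact.out : p.Prime).pos
  set N := Fintype.card (Additive (ZMod p)ˣ) with hN
  have hN0 : (0 : ℝ) < N := by exact_mod_cast Fintype.card_pos (α := Additive (ZMod p)ˣ)
  have hM' : 0 ≤ M' := by
    have : 0 ≤ M' * N := (Finset.sum_nonneg fun _ _ => norm_nonneg _).trans hF'
    exact nonneg_of_mul_nonneg_left this hN0
  have hcorr : ∀ ψ : AddChar (ZMod p) ℂ, ψ ≠ 0 →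
      ‖∑ u : (ZMod p)ˣ, (F' (Additive.ofMul u) : ℂ) * ψ u‖ ≤ M' * √p := by
    intro ψ hψ
    have e : (N : ℂ) * ∑ u : (ZMod p)ˣ, (F' (Additive.ofMul u) : ℂ) * ψ u
        = ∑ χ, fourierSum F' χ * charCorr χ ψ := by
      simp_rw [charCorr, Finset.mul_sum]
      rw [Finset.sum_comm]
      refine Finset.sum_congr rfl fun u _ => ?_
      rw [← mul_assoc, ← fourierSum_inversion, Finset.sum_mul]
      exact Finset.sum_congr rfl fun χ _ => by ring
    have : (N : ℝ) * ‖∑ u : (ZMod p)ˣ, (F' (Additive.ofMul u) : ℂ) * ψ u‖ ≤ N * (M' * √p) := by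
      calc (N : ℝ) * ‖∑ u : (ZMod p)ˣ, (F' (Additive.ofMul u) : ℂ) * ψ u‖
          = ‖(N : ℂ) * ∑ u : (ZMod p)ˣ, (F' (Additive.ofMul u) : ℂ) * ψ u‖ := by
            rw [norm_mul, Complex.norm_natCast]
        _ ≤ ∑ χ, ‖fourierSum F' χ * charCorr χ ψ‖ := by rw [e]; exact norm_sum_le _ _
        _ ≤ ∑ χ, ‖fourierSum F' χ‖ * √p := by
            refine Finset.sum_le_sum fun χ _ => ?_
            rw [norm_mul]
            gcongr
            exact norm_charCorr_le χ hψ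
        _ ≤ M' * N * √p := by rw [← Finset.sum_mul]; gcongr
        _ = _ := by ring
    exact le_of_mul_le_mul_left this hN0
  have e : ((p * ∑ u : (ZMod p)ˣ, F u * F' (Additive.ofMul u) - (∑ x, F x) * ∑ u, F' u : ℝ) : ℂ)
      = ∑ ψ ∈ Finset.univ.erase 0,
        fourierSum F ψ * ∑ u : (ZMod p)ˣ, (F' (Additive.ofMul u) : ℂ) * ψ u := by
    have h0 : fourierSum F 0 * ∑ u : (ZMod p)ˣ,
        (F' (Additive.ofMul u) : ℂ) * (0 : AddChar (ZMod p) ℂ) u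
        = (((∑ x, F x) * ∑ u, F' u : ℝ) : ℂ) := by
      rw [← Equiv.sum_comp Additive.ofMul]
      simp [fourierSum]
    have htot : ((p * ∑ u : (ZMod p)ˣ, F u * F' (Additive.ofMul u) : ℝ) : ℂ)
        = ∑ ψ, fourierSum F ψ * ∑ u : (ZMod p)ˣ, (F' (Additive.ofMul u) : ℂ) * ψ u := by
      simp_rw [Finset.mul_sum]
      rw [Finset.sum_comm]
      push_cast
      refine Finset.sum_congr rfl fun u _ => ?_
      have := fourierSum_inversion F u
      rw [ZMod.card] at this
      rw [← mul_assoc, ← this, Finset.sum_mul]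
      exact Finset.sum_congr rfl fun ψ _ => by ring
    rw [Complex.ofReal_sub, htot, ← h0,
      ← Finset.add_sum_erase _ _ (Finset.mem_univ (0 : AddChar (ZMod p) ℂ)), add_sub_cancel_left]
  have h1 : p * ∑ u : (ZMod p)ˣ, F u * F' (Additive.ofMul u) - (∑ x, F x) * ∑ u, F' u
      ≤ p * (M * M' * √p) := by
    refine (Real.le_norm_self _).trans ?_
    rw [← Complex.norm_real, e]
    calc ‖∑ ψ ∈ Finset.univ.erase 0,
          fourierSum F ψ * ∑ u : (ZMod p)ˣ, (F' (Additive.ofMul u) : ℂ) * ψ u‖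
        ≤ ∑ ψ ∈ Finset.univ.erase 0,
          ‖fourierSum F ψ * ∑ u : (ZMod p)ˣ, (F' (Additive.ofMul u) : ℂ) * ψ u‖ := norm_sum_le _ _
      _ ≤ ∑ ψ ∈ Finset.univ.erase 0, ‖fourierSum F ψ‖ * (M' * √p) := by
          refine Finset.sum_le_sum fun ψ hψ => ?_
          rw [norm_mul]
          gcongr
          exact hcorr ψ (Finset.ne_of_mem_erase hψ)
      _ ≤ ∑ ψ, ‖fourierSum F ψ‖ * (M' * √p) :=
          Finset.sum_le_sum_of_subset_of_nonneg (Finset.erase_subset _ _)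
            fun _ _ _ => by positivity
      _ ≤ M * p * (M' * √p) := by rw [← Finset.sum_mul]; gcongr
      _ = _ := by ring
  have h2 : (p : ℝ) * ∑ u : (ZMod p)ˣ, F u * F' (Additive.ofMul u)
      ≤ p * ((∑ x, F x) * (∑ u, F' u) / p + M * M' * √p) := by
    rw [mul_add, mul_div_cancel₀ _ hp.ne']
    linarith
  exact le_of_mul_le_mul_left h2 hp

end Independence

section LowerBound

variable {p : ℕ} [Fact p.Prime]

/-- The units lying in `A`, as a subset of an additive group. -/
def unitPart (A : Finset (ZMod p)) : Finset (Additive (ZMod p)ˣ) :=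
  Finset.univ.filter fun u => ((Additive.toMul u : (ZMod p)ˣ) : ZMod p) ∈ A

lemma card_le_card_unitPart_add_one (A : Finset (ZMod p)) : A.card ≤ (unitPart A).card + 1 := by
  have : A ⊆ insert 0 ((unitPart A).image fun u => ((Additive.toMul u : (ZMod p)ˣ) : ZMod p)) := by
    intro x hx
    rcases eq_or_ne x 0 with rfl | h
    · exact Finset.mem_insert_self _ _
    · refine Finset.mem_insert_of_mem (Finset.mem_image.2 ⟨Additive.ofMul (Units.mk0 x h), ?_, rfl⟩)
      exact Finset.mem_filter.2 ⟨Finset.mem_univ _, hx⟩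
  exact (Finset.card_le_card this).trans ((Finset.card_insert_le _ _).trans
    (Nat.add_le_add_right Finset.card_image_le 1))

lemma card_unitPart_add_le (A : Finset (ZMod p)) :
    (unitPart A + unitPart A).card ≤ (A * A).card := by
  refine Finset.card_le_card_of_injOn (fun u => ((Additive.toMul u : (ZMod p)ˣ) : ZMod p)) ?_
    (Units.val_injective.comp Additive.toMul.injective).injOn
  intro u hu
  obtain ⟨v, hv, w, hw, rfl⟩ := Finset.mem_add.1 hu
  exact Finset.mul_mem_mul (Finset.mem_filter.1 hv).2 (Finset.mem_filter.1 hw).2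

lemma card_popular_le_add {G : Type*} [AddCommGroup G] [Fintype G] [DecidableEq G]
    (A S : Finset G) (τ : ℝ) :
    (Finset.univ.filter fun x => τ ≤ sumRep S x).card
      ≤ (A + A).card + (Finset.univ.filter fun x => τ ≤ sumRep S x ∧ x ∉ A + A).card := by
  refine (Finset.card_le_card fun x hx => ?_).trans (Finset.card_union_le _ _)
  simp only [Finset.mem_union, Finset.mem_filter, Finset.mem_univ, true_and] at hx ⊢
  tauto

/-- Up to a small error, a dense subset of `ℤ/p` lies in the intersection of an additively
structured set and a multiplicatively structured set, which are independent. -/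
theorem exists_structured_pair {ε : ℝ} (hε : 0 < ε) (hε1 : ε ≤ 1) :
    ∃ P₀ : ℝ, ∀ (p : ℕ) [Fact p.Prime], P₀ ≤ p → ∀ A : Finset (ZMod p),
      ∃ σ τ : ℝ, 0 ≤ σ ∧ σ ≤ 1 ∧ 0 ≤ τ ∧ τ ≤ 1 ∧ A.card ≤ (σ * τ + 4 * ε) * p ∧
        (min 1 (2 * σ) - 2 * ε) * p ≤ (A + A).card ∧
        ∀ l : ℕ, 1 ≤ l → 1 / (l + 1) + ε ≤ τ → (1 / l - 2 * ε) * p ≤ (A * A).card := by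
  obtain ⟨M, hM, hadd⟩ := exists_structured_superset hε (θ := ε ^ 2 / 8) (by positivity)
  obtain ⟨M', hM', hmul⟩ := exists_structured_superset hε (θ := (ε / 8) ^ 2) (by positivity)
  refine ⟨max (4 / ε) (max (1 / ε) ((M * M' / ε) ^ 2)), ?_⟩
  intro p _ hpP A
  have hpε : 4 / ε ≤ p := (le_max_left _ _).trans hpP
  have hpε1 : 1 / ε ≤ p := (le_max_left _ _).trans ((le_max_right _ _).trans hpP)
  have hpM : (M * M' / ε) ^ 2 ≤ p := (le_max_right _ _).trans ((le_max_right _ _).trans hpP)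
  have hp1 : 1 < p := (Fact.out : p.Prime).one_lt
  have hp : (0 : ℝ) < p := by exact_mod_cast hp1.pos
  rw [div_le_iff₀ hε] at hpε1
  have hsqrt : M * M' * √p ≤ ε * p := by
    have h1 : M * M' / ε ≤ √p := Real.le_sqrt_of_sq_le hpM
    rw [div_le_iff₀ hε] at h1
    calc M * M' * √p ≤ √p * ε * √p := by gcongr
      _ = ε * (√p * √p) := by ring
      _ = ε * p := by rw [Real.mul_self_sqrt hp.le]
  have hcard : Fintype.card (Additive (ZMod p)ˣ) = p - 1 := by
    rw [Fintype.card_additive, ZMod.card_units]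
  have hcard' : ((Fintype.card (Additive (ZMod p)ˣ) : ℕ) : ℝ) = p - 1 := by
    rw [hcard, Nat.cast_sub hp1.le, Nat.cast_one]
  have hp1' : (0 : ℝ) < p - 1 := by
    rw [sub_pos]
    exact_mod_cast hp1
  obtain ⟨S, F, hF0, hFA, hFS, hFM, hpop⟩ := hadd (ZMod p) A
  obtain ⟨S', F', hF0', hFA', hFS', hFM', hpop'⟩ := hmul (Additive (ZMod p)ˣ) (unitPart A)
  rw [ZMod.card] at hFA hFM hpop
  have hind := sum_units_mul_le hFM hFM'
  rw [hcard'] at hFA' hpop'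
  have hSp : (S.card : ℝ) ≤ p := by
    exact_mod_cast (Finset.card_le_univ S).trans (ZMod.card p).le
  have hSp' : (S'.card : ℝ) ≤ p - 1 := by
    rw [← hcard']
    exact_mod_cast Finset.card_le_univ S'
  refine ⟨S.card / p, S'.card / (p - 1), by positivity, div_le_one_of_le₀ hSp hp.le,
    div_nonneg (Nat.cast_nonneg _) hp1'.le, div_le_one_of_le₀ hSp' hp1'.le, ?_, ?_, ?_⟩
  · have hcover : ((unitPart A).card : ℝ) ≤ (A.filter fun x => F x < 1).card
        + ((unitPart A).filter fun x => F' x < 1).card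
        + ∑ u : (ZMod p)ˣ, F u * F' (Additive.ofMul u) := by
      set B := (unitPart A).filter fun u => F (Additive.toMul u : (ZMod p)ˣ) < 1
      set B' := (unitPart A).filter fun x => F' x < 1
      have hB : B.card ≤ (A.filter fun x => F x < 1).card := by
        refine Finset.card_le_card_of_injOn (fun u => ((Additive.toMul u : (ZMod p)ˣ) : ZMod p)) ?_
          (Units.val_injective.comp Additive.toMul.injective).injOn
        intro u hu
        obtain ⟨hu1, hu2⟩ := Finset.mem_filter.1 hu
        exact Finset.mem_filter.2 ⟨(Finset.mem_filter.1 hu1).2, hu2⟩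
      have hrest : (((unitPart A) \ (B ∪ B')).card : ℝ)
          ≤ ∑ u : (ZMod p)ˣ, F u * F' (Additive.ofMul u) := by
        have : ∑ u : (ZMod p)ˣ, F u * F' (Additive.ofMul u)
            = ∑ u : Additive (ZMod p)ˣ, F (Additive.toMul u : (ZMod p)ˣ) * F' u :=
          Equiv.sum_comp Additive.ofMul fun u => F (Additive.toMul u : (ZMod p)ˣ) * F' u
        rw [this]
        calc (((unitPart A) \ (B ∪ B')).card : ℝ) = ∑ u ∈ (unitPart A) \ (B ∪ B'), 1 := by simp
          _ ≤ ∑ u ∈ (unitPart A) \ (B ∪ B'), F (Additive.toMul u : (ZMod p)ˣ) * F' u := by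
              refine Finset.sum_le_sum fun u hu => ?_
              simp only [B, B', Finset.mem_sdiff, Finset.mem_union, Finset.mem_filter, not_or,
                not_and, not_lt] at hu
              exact one_le_mul_of_one_le_of_one_le (hu.2.1 hu.1) (hu.2.2 hu.1)
          _ ≤ _ := Finset.sum_le_sum_of_subset_of_nonneg (Finset.subset_univ _)
              fun u _ _ => mul_nonneg (hF0 _) (hF0' _)
      have h1 : (unitPart A).card ≤ (unitPart A \ (B ∪ B')).card + (B.card + B'.card) :=
        (Finset.card_le_card_sdiff_add_card).trans
          (Nat.add_le_add_left (Finset.card_union_le _ _) _)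
      have h2 : ((unitPart A).card : ℝ) ≤ (unitPart A \ (B ∪ B')).card + (B.card + B'.card) := by
        exact_mod_cast h1
      have h3 : (B.card : ℝ) ≤ (A.filter fun x => F x < 1).card := by exact_mod_cast hB
      linarith
    have h1 : (A.card : ℝ) ≤ (unitPart A).card + 1 := by
      exact_mod_cast card_le_card_unitPart_add_one A
    rw [hFS, hFS'] at hind
    have h2 : (S.card : ℝ) * S'.card / p ≤ S.card / p * (S'.card / (p - 1)) * p := by
      rw [div_mul_div_comm, div_mul_eq_mul_div, div_le_div_iff₀ hp (by positivity)]
      have : (0 : ℝ) ≤ S.card * S'.card * p := by positivity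
      nlinarith
    linarith
  · have h1 := card_popular_sums_zmod hε hpε S
    have h2 : ((Finset.univ.filter fun x => ε ^ 2 / 8 * p ≤ sumRep S x).card : ℝ)
        ≤ (A + A).card
          + (Finset.univ.filter fun x => ε ^ 2 / 8 * p ≤ sumRep S x ∧ x ∉ A + A).card := by
      exact_mod_cast card_popular_le_add A S _
    have h3 : min 1 (2 * (S.card / p : ℝ)) * p = min (p : ℝ) (2 * S.card) := by
      rw [min_mul_of_nonneg _ _ hp.le, one_mul, mul_assoc, div_mul_cancel₀ _ hp.ne']
    rw [sub_mul, h3]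
    linarith
  · intro l hl hτ
    have hl0 : (1 : ℝ) ≤ l := by exact_mod_cast hl
    rw [le_div_iff₀ hp1', ← hcard'] at hτ
    have h1 := card_popular_sums hl hε hε1 hτ
    have h1' : (p - 1 : ℝ) ≤ l * ((Finset.univ.filter fun x =>
        (ε / 8) ^ 2 * (Fintype.card (Additive (ZMod p)ˣ) : ℕ) ≤ sumRep S' x).card : ℝ) := by
      rw [← hcard']
      exact_mod_cast h1
    have h2 := card_popular_le_add (unitPart A) S'
      ((ε / 8) ^ 2 * (Fintype.card (Additive (ZMod p)ˣ) : ℕ))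
    have h3 := h2.trans (Nat.add_le_add_right (card_unitPart_add_le A) _)
    have h3' : ((Finset.univ.filter fun x =>
        (ε / 8) ^ 2 * (Fintype.card (Additive (ZMod p)ˣ) : ℕ) ≤ sumRep S' x).card : ℝ)
        ≤ (A * A).card + ε * (p - 1) := by
      refine le_trans ?_ (add_le_add_right hpop' _)
      rw [← hcard']
      exact_mod_cast h3
    have h4 : (p - 1 : ℝ) / l ≤ (A * A).card + ε * (p - 1) := by
      rw [div_le_iff₀ (by positivity), mul_comm]
      exact h1'.trans (by gcongr)
    have h5 : (1 : ℝ) / l ≤ 1 := by rw [div_le_one₀ (by positivity)]; exact hl0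
    have h6 : (p - 1 : ℝ) / l = 1 / l * p - 1 / l := by ring
    nlinarith

/-- The lower bound for `max |A + A| |A * A|`. -/
theorem le_max_card {α v : ℝ} (hα : 0 < α) (hα1 : α < 1) (hv1 : v ≤ 1)
    (hv : ∀ l : ℕ, 1 ≤ l → v ≤ max (2 * (l : ℝ) * α) (1 / (l : ℝ))) {γ : ℝ} (hγ : 0 < γ)
    (hγ1 : γ ≤ 1) :
    ∃ P₀ : ℝ, ∀ (p : ℕ) [Fact p.Prime], P₀ ≤ p → ∀ A : Finset (ZMod p), α * p ≤ A.card →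
      (v - γ) * p ≤ max ((A + A).card : ℝ) (A * A).card := by
  set ε := α * γ / 36 with hε
  have hε0 : 0 < ε := by positivity
  have hεα : ε ≤ α / 36 := by rw [hε]; gcongr; nlinarith
  obtain ⟨P₀, h⟩ := exists_structured_pair hε0 (by linarith)
  refine ⟨P₀, fun p _ hp A hA => ?_⟩
  obtain ⟨σ, τ, hσ0, hσ1, hτ0, hτ1, hστ, hadd, hmul⟩ := h p hp A
  have hp0 : (0 : ℝ) < p := by exact_mod_cast (Fact.out : p.Prime).pos
  have hστ' : α - 4 * ε ≤ σ * τ := by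
    have := le_of_mul_le_mul_right (hA.trans hστ) hp0
    linarith
  have hτα : α - 4 * ε ≤ τ := hστ'.trans (by nlinarith)
  have hτε : 0 < τ - ε := by linarith
  set l := ⌊1 / (τ - ε)⌋₊ with hl
  have hl1 : 1 ≤ l := by
    apply Nat.le_floor
    rw [Nat.cast_one, le_div_iff₀ hτε]
    linarith
  have hl0 : (1 : ℝ) ≤ l := by exact_mod_cast hl1
  have hle : (l : ℝ) * (τ - ε) ≤ 1 := by
    rw [← le_div_iff₀ hτε]
    exact Nat.floor_le (by positivity)
  have hgt : 1 / ((l : ℝ) + 1) ≤ τ - ε := by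
    rw [div_le_iff₀ (by positivity), mul_comm, ← div_le_iff₀ hτε]
    exact (Nat.lt_floor_add_one _).le
  have hεγ : ε ≤ γ / 36 := by rw [hε]; gcongr; nlinarith
  rcases le_max_iff.1 (hv l hl1) with h1 | h1
  · refine le_max_of_le_left (le_trans ?_ hadd)
    refine mul_le_mul_of_nonneg_right ?_ hp0.le
    have hlε : (l : ℝ) * ε ≤ γ / 18 := by
      have : (l : ℝ) * (α / 2) ≤ 1 := le_trans (by gcongr; linarith) hle
      rw [hε]
      nlinarith
    have hσ : (l : ℝ) * α - 5 * (l * ε) ≤ σ := by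
      have h2 : (l : ℝ) * (α - 4 * ε) ≤ l * (σ * τ) := by gcongr
      have h3 : σ * (l * τ) ≤ σ * (1 + l * ε) := by gcongr; linarith
      have h4 : σ * (l * ε) ≤ l * ε := mul_le_of_le_one_left (by positivity) hσ1
      linarith
    have : v - γ + 2 * ε ≤ min 1 (2 * σ) := le_min (by linarith) (by linarith)
    linarith
  · refine le_max_of_le_right (le_trans ?_ (hmul l hl1 (by linarith)))
    refine mul_le_mul_of_nonneg_right ?_ hp0.le
    linarith

end LowerBound

section UpperBound

variable {p : ℕ} [Fact p.Prime]

/-- The nonzero `l`-th powers form a multiplicatively closed set of size `(p - 1) / l`. -/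
lemma exists_card_eq_mul_self_subset {l : ℕ} (hl : l ∣ p - 1) :
    ∃ H : Finset (ZMod p), H.card = (p - 1) / l ∧ H * H ⊆ H := by
  classical
  let K : Subgroup (ZMod p)ˣ := (powMonoidHom l).range
  have hK : Nat.card K = (p - 1) / l := by
    have := IsCyclic.card_powMonoidHom_range (G := (ZMod p)ˣ) l
    rwa [Nat.card_eq_fintype_card (α := (ZMod p)ˣ), ZMod.card_units, Nat.gcd_eq_right hl] at this
  refine ⟨(Finset.univ.filter fun u => u ∈ K).map ⟨((↑) : (ZMod p)ˣ → ZMod p),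
    Units.val_injective⟩, ?_, ?_⟩
  · rw [Finset.card_map, ← hK, Nat.card_eq_fintype_card, Fintype.card_subtype]
  · intro x hx
    obtain ⟨y, hy, z, hz, rfl⟩ := Finset.mem_mul.1 hx
    obtain ⟨u, hu, rfl⟩ := Finset.mem_map.1 hy
    obtain ⟨v, hv, rfl⟩ := Finset.mem_map.1 hz
    refine Finset.mem_map.2 ⟨u * v, ?_, by simp⟩
    simp only [Finset.mem_filter, Finset.mem_univ, true_and] at hu hv ⊢
    exact K.mul_mem hu hv

/-- Some translate of `I` meets `H` in at least the average proportion. -/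
lemma exists_card_mul_card_le_inter {G : Type*} [AddCommGroup G] [Fintype G] [DecidableEq G]
    (H I : Finset G) : ∃ t : G,
      H.card * I.card ≤ Fintype.card G * (H ∩ I.image fun x => x + t).card := by
  by_contra! h
  have h1 : ∑ t : G, (H ∩ I.image fun x => x + t).card = H.card * I.card := by
    have : ∀ t, (H ∩ I.image fun x => x + t).card = ∑ x ∈ H, if x - t ∈ I then 1 else 0 := by
      intro t
      rw [← Finset.card_filter]
      congr 1
      ext x
      simp only [Finset.mem_inter, Finset.mem_filter, Finset.mem_image, and_congr_right_iff]
      refine fun _ => ⟨?_, fun hx => ⟨_, hx, by abel⟩⟩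
      rintro ⟨y, hy, rfl⟩
      simpa using hy
    simp_rw [this]
    rw [Finset.sum_comm]
    have : ∀ x ∈ H, ∑ t, (if x - t ∈ I then 1 else 0) = I.card := by
      intro x _
      exact (Equiv.sum_comp (Equiv.subLeft x) fun y => if y ∈ I then 1 else 0).trans (by simp)
    rw [Finset.sum_congr rfl this]
    simp
  have h2 : ∑ t : G, Fintype.card G * (H ∩ I.image fun x => x + t).card
      < ∑ _t : G, H.card * I.card := Finset.sum_lt_sum_of_nonempty ⟨0, Finset.mem_univ _⟩
        fun t _ => h t
  rw [← Finset.mul_sum, h1] at h2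
  simp at h2

/-- The intersection of the `l`-th powers with a suitable interval has few sums and products. -/
lemma exists_few_sums_products {l : ℕ} (hl : l ∣ p - 1) {L : ℕ} (hL : L ≤ p) :
    ∃ A : Finset (ZMod p), (p - 1) / l * L ≤ p * A.card ∧ (A + A).card ≤ 2 * L ∧
      (A * A).card ≤ (p - 1) / l := by
  obtain ⟨H, hHc, hH⟩ := exists_card_eq_mul_self_subset hl
  set I : Finset (ZMod p) := (Finset.range L).image fun n : ℕ => (n : ZMod p)
  have hI : I.card = L := by
    rw [Finset.card_image_of_injOn, Finset.card_range]
    intro a ha b hb hab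
    simp only [Finset.coe_range, Set.mem_Iio] at ha hb
    have := (ZMod.natCast_eq_natCast_iff' a b p).1 hab
    rwa [Nat.mod_eq_of_lt (ha.trans_le hL), Nat.mod_eq_of_lt (hb.trans_le hL)] at this
  obtain ⟨t, ht⟩ := exists_card_mul_card_le_inter H I
  rw [hHc, hI, ZMod.card] at ht
  refine ⟨_, ht, ?_, ?_⟩
  · have : (H ∩ I.image fun x => x + t) + (H ∩ I.image fun x => x + t)
        ⊆ (Finset.range (2 * L)).image fun n : ℕ => (n : ZMod p) + (t + t) := by
      intro x hx
      obtain ⟨y, hy, z, hz, rfl⟩ := Finset.mem_add.1 hx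
      obtain ⟨y', hy', rfl⟩ := Finset.mem_image.1 (Finset.mem_inter.1 hy).2
      obtain ⟨z', hz', rfl⟩ := Finset.mem_image.1 (Finset.mem_inter.1 hz).2
      obtain ⟨m, hm, rfl⟩ := Finset.mem_image.1 hy'
      obtain ⟨n, hn, rfl⟩ := Finset.mem_image.1 hz'
      rw [Finset.mem_range] at hm hn
      refine Finset.mem_image.2 ⟨m + n, Finset.mem_range.2 (by omega), ?_⟩
      push_cast
      abel
    exact (Finset.card_le_card this).trans (Finset.card_image_le.trans (Finset.card_range _).le)
  · rw [← hHc]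
    exact Finset.card_le_card ((Finset.mul_subset_mul Finset.inter_subset_left
      Finset.inter_subset_left).trans hH)

/-- The upper bound for the minimum, for primes that are `1` modulo `l`. -/
theorem minSumProd_div_le {α : ℝ} (hα : 0 < α) {l : ℕ} (hl1 : 1 ≤ l) (hlα : 2 * l * α < 1)
    (hp4 : 4 ≤ p) (hl : l ∣ p - 1) :
    (minSumProd α p : ℝ) / p ≤ max (2 * (l : ℝ) * α) (1 / (l : ℝ)) + 4 / p := by
  have hp1 : (0 : ℝ) < p - 1 := by
    have : (4 : ℝ) ≤ p := by exact_mod_cast hp4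
    linarith
  have hp4' : (4 : ℝ) ≤ p := by exact_mod_cast hp4
  have hp : (0 : ℝ) < p := by linarith
  have hl0 : (0 : ℝ) < l := by exact_mod_cast hl1
  obtain ⟨n, hn⟩ := hl
  have hdiv : (p - 1) / l = n := by rw [hn, Nat.mul_div_cancel_left _ hl1]
  have hn' : (p : ℝ) - 1 = l * n := by
    rw [← Nat.cast_mul, ← hn, Nat.cast_sub (by omega), Nat.cast_one]
  set x : ℝ := l * α * p ^ 2 / (p - 1) with hx
  have hx0 : 0 ≤ x := by positivity
  have hx1 : x ≤ l * α * p + 1 := by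
    rw [hx, div_le_iff₀ hp1]
    nlinarith
  have hLp : ⌈x⌉₊ ≤ p := by
    rw [Nat.ceil_le]
    nlinarith
  obtain ⟨A, hA, hadd, hmul⟩ := exists_few_sums_products (Dvd.intro n hn.symm) hLp
  rw [hdiv] at hA hmul
  have hAα : α * p ≤ A.card := by
    have h1 : (n : ℝ) * x ≤ p * A.card := by
      calc (n : ℝ) * x ≤ n * ⌈x⌉₊ := by gcongr; exact Nat.le_ceil x
        _ ≤ p * A.card := by exact_mod_cast hA
    have h2 : (n : ℝ) * x = α * p * p := by
      rw [hx, hn']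
      have : (n : ℝ) ≠ 0 := by
        rintro h
        rw [hn', h, mul_zero] at hp1
        exact hp1.false
      field_simp
    rw [h2, mul_comm (p : ℝ)] at h1
    exact le_of_mul_le_mul_right h1 hp
  have hle : minSumProd α p ≤ max (A + A).card (A * A).card := Nat.sInf_le ⟨A, hAα, rfl⟩
  have hle' : (minSumProd α p : ℝ) ≤ max ((A + A).card : ℝ) (A * A).card := by exact_mod_cast hle
  rw [div_le_iff₀ hp, add_mul, div_mul_cancel₀ _ hp.ne']
  refine hle'.trans (max_le ?_ ?_)
  · have h1 : ((A + A).card : ℝ) ≤ 2 * ⌈x⌉₊ := by exact_mod_cast hadd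
    have h2 := (Nat.ceil_lt_add_one hx0).le
    have h3 : 2 * (l : ℝ) * α * p ≤ max (2 * (l : ℝ) * α) (1 / (l : ℝ)) * p := by
      gcongr
      exact le_max_left _ _
    linarith
  · have h1 : ((A * A).card : ℝ) ≤ n := by exact_mod_cast hmul
    have h2 : 1 / (l : ℝ) * p ≤ max (2 * (l : ℝ) * α) (1 / (l : ℝ)) * p := by
      gcongr
      exact le_max_right _ _
    have h3 : (n : ℝ) ≤ 1 / l * p := by
      rw [div_mul_eq_mul_div, one_mul, le_div_iff₀ hl0]
      linarith
    linarith

end UpperBound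

section Main

instance neBot_atTop_inf_principal_prime : (atTop ⊓ 𝓟 {p : ℕ | p.Prime}).NeBot :=
  frequently_mem_iff_neBot.1
    ((Nat.frequently_atTop_modEq_one one_ne_zero).mono fun _ h => h.1)

lemma isBoundedUnder_ge_minSumProd {α : ℝ} (hα : α ≤ 1) :
    (atTop ⊓ 𝓟 {p : ℕ | p.Prime}).IsBoundedUnder (· ≥ ·)
      fun p : ℕ => (minSumProd α p : ℝ) / p :=
  isBoundedUnder_of_eventually_ge (a := 0) (eventually_inf_principal.2
    (Eventually.of_forall fun _ hp => (minSumProd_div_mem hα hp).1))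

lemma isBoundedUnder_le_minSumProd {α : ℝ} (hα : α ≤ 1) :
    (atTop ⊓ 𝓟 {p : ℕ | p.Prime}).IsBoundedUnder (· ≤ ·)
      fun p : ℕ => (minSumProd α p : ℝ) / p :=
  isBoundedUnder_of_eventually_le (a := 1) (eventually_inf_principal.2
    (Eventually.of_forall fun _ hp => (minSumProd_div_mem hα hp).2))

lemma sumProdLiminf_le_one {α : ℝ} (hα : α ≤ 1) : sumProdLiminf α ≤ 1 :=
  liminf_le_of_frequently_le (Eventually.frequently (eventually_inf_principal.2
    (Eventually.of_forall fun _ hp => (minSumProd_div_mem hα hp).2)))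
    (isBoundedUnder_ge_minSumProd hα)

lemma le_sumProdLiminf {α v : ℝ} (hα : α ∈ Set.Ioo (0 : ℝ) 1) (hv1 : v ≤ 1)
    (hv : ∀ l : ℕ, 1 ≤ l → v ≤ max (2 * (l : ℝ) * α) (1 / (l : ℝ))) : v ≤ sumProdLiminf α := by
  have key : ∀ γ : ℝ, 0 < γ → γ ≤ 1 → v - γ ≤ sumProdLiminf α := by
    intro γ hγ hγ1
    obtain ⟨P₀, h⟩ := le_max_card hα.1 hα.2 hv1 hv hγ hγ1
    refine le_liminf_of_le (isBoundedUnder_le_minSumProd hα.2.le).isCoboundedUnder_ge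
      (eventually_inf_principal.2 ?_)
    filter_upwards [eventually_ge_atTop ⌈P₀⌉₊] with p hp hprime
    have : Fact p.Prime := ⟨hprime⟩
    have hp0 : (0 : ℝ) < p := by exact_mod_cast Nat.Prime.pos hprime
    obtain ⟨A, hA, hmin⟩ := (isLeast_minSumProd hα.2.le hprime).1
    rw [le_div_iff₀ hp0, hmin]
    push_cast
    exact h p (Nat.ceil_le.1 hp) A hA
  refine le_of_forall_pos_sub_le fun γ hγ => ?_
  exact le_trans (by linarith [min_le_left γ 1]) (key (min γ 1) (by positivity) (min_le_right _ _))

lemma sumProdLiminf_le {α : ℝ} (hα : α ∈ Set.Ioo (0 : ℝ) 1) {l : ℕ} (hl : 1 ≤ l) :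
    sumProdLiminf α ≤ max (2 * (l : ℝ) * α) (1 / (l : ℝ)) := by
  rcases le_or_gt 1 (2 * (l : ℝ) * α) with h | h
  · exact (sumProdLiminf_le_one hα.2.le).trans (h.trans (le_max_left _ _))
  refine le_of_forall_pos_le_add fun γ hγ => ?_
  refine liminf_le_of_frequently_le (frequently_inf_principal.2 ?_)
    (isBoundedUnder_ge_minSumProd hα.2.le)
  refine ((Nat.frequently_atTop_modEq_one (k := l) (by omega)).and_eventually
    ((eventually_ge_atTop 4).and (eventually_ge_atTop ⌈4 / γ⌉₊))).mono ?_
  rintro p ⟨⟨hprime, hmod⟩, hp4, hpγ⟩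
  refine ⟨hprime, ?_⟩
  have : Fact p.Prime := ⟨hprime⟩
  have hp0 : (0 : ℝ) < p := by exact_mod_cast hprime.pos
  refine (minSumProd_div_le hα.1 hl h hp4
    ((Nat.modEq_iff_dvd' hprime.one_lt.le).1 hmod.symm)).trans ?_
  have : 4 / (p : ℝ) ≤ γ := by
    rw [div_le_comm₀ hp0 hγ]
    exact Nat.ceil_le.1 hpγ
  linarith

/-- The values of which `sumProdLiminf` is the minimum. -/
def sumProdBounds (α : ℝ) : Set ℝ :=
  {x : ℝ | ∃ l : ℕ, 1 ≤ l ∧ x = max (2 * (l : ℝ) * α) (1 / (l : ℝ))}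

lemma exists_isLeast_sumProdBounds {α : ℝ} (hα : α ∈ Set.Ioo (0 : ℝ) 1) :
    ∃ m, IsLeast (sumProdBounds α) m := by
  set K := ⌈1 / α⌉₊ with hK
  have hK1 : 1 ≤ K := Nat.one_le_ceil_iff.2 (by have := hα.1; positivity)
  obtain ⟨k, hk, hmin⟩ := (Finset.Icc 1 K).exists_min_image
    (fun l : ℕ => max (2 * (l : ℝ) * α) (1 / (l : ℝ))) ⟨1, Finset.mem_Icc.2 ⟨le_rfl, hK1⟩⟩
  refine ⟨_, ⟨k, (Finset.mem_Icc.1 hk).1, rfl⟩, ?_⟩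
  rintro x ⟨l, hl, rfl⟩
  rcases le_or_gt l K with h | h
  · exact hmin l (Finset.mem_Icc.2 ⟨hl, h⟩)
  · refine (hmin 1 (Finset.mem_Icc.2 ⟨le_rfl, hK1⟩)).trans (le_max_of_le_left ?_)
    have h1 : 1 / α ≤ l := (Nat.le_ceil _).trans (by exact_mod_cast h.le)
    rw [div_le_iff₀ hα.1] at h1
    have := hα.2
    push_cast
    exact max_le (by linarith) (by linarith)

lemma sumProdLiminf_eq {α m : ℝ} (hα : α ∈ Set.Ioo (0 : ℝ) 1) (hm : IsLeast (sumProdBounds α) m) :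
    sumProdLiminf α = min 1 m := by
  apply le_antisymm
  · refine le_min (sumProdLiminf_le_one hα.2.le) ?_
    obtain ⟨l, hl, rfl⟩ := hm.1
    exact sumProdLiminf_le hα hl
  · exact le_sumProdLiminf hα (min_le_left _ _) fun l hl =>
      (min_le_right _ _).trans (hm.2 ⟨l, hl, rfl⟩)

lemma isLeast_sumProdLiminf {α : ℝ} (hα : α ∈ Set.Ioc (0 : ℝ) (1 / 2)) :
    IsLeast (sumProdBounds α) (sumProdLiminf α) := by
  have hα' : α ∈ Set.Ioo (0 : ℝ) 1 := ⟨hα.1, by linarith [hα.2]⟩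
  obtain ⟨m, hm⟩ := exists_isLeast_sumProdBounds hα'
  have : m ≤ 1 := by
    refine hm.2 ⟨1, le_rfl, ?_⟩
    rw [Nat.cast_one, div_one, max_eq_right]
    linarith [hα.2]
  rwa [sumProdLiminf_eq hα' hm, min_eq_right this]

lemma sumProdLiminf_isEquivalent :
    (fun α : ℝ => sumProdLiminf α) ~[𝓝[>] (0 : ℝ)] (fun α : ℝ => (2 * α) ^ (1 / 2 : ℝ)) := by
  simp_rw [← Real.sqrt_eq_rpow]
  have hmem : ∀ᶠ α in 𝓝[>] (0 : ℝ), α ∈ Set.Ioc (0 : ℝ) (1 / 2) :=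
    Ioc_mem_nhdsGT (by norm_num)
  have hpos : ∀ {α : ℝ}, α ∈ Set.Ioc (0 : ℝ) (1 / 2) → 0 < √(2 * α) := fun h =>
    Real.sqrt_pos.2 (by linarith [h.1])
  have hlow : ∀ {α : ℝ}, α ∈ Set.Ioc (0 : ℝ) (1 / 2) → √(2 * α) ≤ sumProdLiminf α := by
    intro α hα
    obtain ⟨l, hl, h⟩ := (isLeast_sumProdLiminf hα).1
    have hl0 : (0 : ℝ) < l := by exact_mod_cast hl
    have h1 : 2 * l * α ≤ sumProdLiminf α := by rw [h]; exact le_max_left _ _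
    have h2 : 1 / (l : ℝ) ≤ sumProdLiminf α := by rw [h]; exact le_max_right _ _
    have h3 : 0 ≤ sumProdLiminf α := le_trans (by positivity) h2
    refine (Real.sqrt_le_left h3).2 ?_
    calc 2 * α = 2 * l * α * (1 / l) := by field_simp
      _ ≤ sumProdLiminf α * sumProdLiminf α := mul_le_mul h1 h2 (by positivity) h3
      _ = _ := (pow_two _).symm
  have hupp : ∀ {α : ℝ}, α ∈ Set.Ioc (0 : ℝ) (1 / 2) →
      sumProdLiminf α ≤ √(2 * α) + √(2 * α) * √(2 * α) := by
    intro α hα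
    have hs := hpos hα
    have hss : √(2 * α) * √(2 * α) = 2 * α := Real.mul_self_sqrt (by linarith [hα.1])
    have hle := Nat.le_ceil (1 / √(2 * α))
    have hlt := Nat.ceil_lt_add_one (a := 1 / √(2 * α)) (by positivity)
    have hl1 : 1 ≤ ⌈1 / √(2 * α)⌉₊ := Nat.one_le_ceil_iff.2 (by positivity)
    have hl0 : (0 : ℝ) < ⌈1 / √(2 * α)⌉₊ := by exact_mod_cast hl1
    refine ((isLeast_sumProdLiminf hα).2 ⟨_, hl1, rfl⟩).trans (max_le ?_ ?_)
    · calc 2 * (⌈1 / √(2 * α)⌉₊ : ℝ) * α = √(2 * α) * √(2 * α) * ⌈1 / √(2 * α)⌉₊ := by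
            rw [hss]; ring
        _ ≤ √(2 * α) * √(2 * α) * (1 / √(2 * α) + 1) := by gcongr
        _ = _ := by field_simp
    · rw [div_le_comm₀ hl0 (by positivity)]
      refine le_trans ?_ hle
      gcongr
      nlinarith
  refine isEquivalent_of_tendsto_one ?_
  have hlim : Tendsto (fun α : ℝ => 1 + √(2 * α)) (𝓝[>] 0) (𝓝 1) := by
    have : Continuous fun α : ℝ => 1 + √(2 * α) := by fun_prop
    simpa using (this.tendsto 0).mono_left nhdsWithin_le_nhds
  refine tendsto_of_tendsto_of_tendsto_of_le_of_le' tendsto_const_nhds hlim ?_ ?_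
  · filter_upwards [hmem] with α hα
    rw [Pi.div_apply, le_div_iff₀ (hpos hα), one_mul]
    exact hlow hα
  · filter_upwards [hmem] with α hα
    rw [Pi.div_apply, div_le_iff₀ (hpos hα), add_mul, one_mul]
    exact hupp hα

end Main

theorem theorem1 :
    (∀ α ∈ Set.Ioo (0 : ℝ) 1,
      IsLeast (insert 1 {x : ℝ | ∃ l : ℕ, 1 ≤ l ∧ x = max (2 * (l : ℝ) * α) (1 / (l : ℝ))})
        (sumProdLiminf α)) ∧
    (∀ α ∈ Set.Ioc (0 : ℝ) (1 / 2),
      IsLeast {x : ℝ | ∃ l : ℕ, 1 ≤ l ∧ x = max (2 * (l : ℝ) * α) (1 / (l : ℝ))}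
        (sumProdLiminf α)) ∧
    (∀ α ∈ Set.Ico (1 / 4 : ℝ) 1, sumProdLiminf α = 1) ∧
    (fun α : ℝ => sumProdLiminf α) ~[𝓝[>] (0 : ℝ)] (fun α : ℝ => (2 * α) ^ (1 / 2 : ℝ)) := by
  refine ⟨fun α hα => ?_, fun α hα => isLeast_sumProdLiminf hα, fun α hα => ?_,
    sumProdLiminf_isEquivalent⟩
  · obtain ⟨m, hm⟩ := exists_isLeast_sumProdBounds hα
    rw [sumProdLiminf_eq hα hm]
    exact hm.insert 1
  · refine le_antisymm (sumProdLiminf_le_one hα.2.le)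
      (le_sumProdLiminf ⟨by linarith [hα.1], hα.2⟩ le_rfl fun l hl => ?_)
    rcases hl.eq_or_lt with rfl | hl2
    · exact le_max_of_le_right (by norm_num)
    · have : (2 : ℝ) ≤ l := by exact_mod_cast hl2
      exact le_max_of_le_left (by nlinarith [hα.1])
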